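/- Let $(M,g)$ be a connected, complete, finite-dimensional smooth Riemannian manifold with Levi-Civita connection $\nabla$. For $x,y\in M$, a \emph{length minimizing geodesic} from $x$ to $y$ is a curve $\gamma:[0,1]\to M$ with $\nabla_{\gamma'}\gamma'=0$, $\gamma(0)=x$, $\gamma(1)=y$, whose length is the Riemannian distance from $x$ to $y$ (constant curves are allowed when $x=y$). A set $A\subseteq M$ is \emph{geodesically convex} if any two points $x,y\in A$ are joined by a length minimizing geodesic $\gamma$ with $\gamma([0,1])\subseteq A$. For $p\in M$, a \emph{direction function} at $p$ is a map $\eta_p:M\to T_pM$ such that, for every $x\in M$, $\eta_p(x)=\gamma'(0)$ for some length minimizing geodesic $\gamma$ from $p$ to $x$. For $\lambda\in(0,1]$, the \emph{$\lambda$-radial contraction} based at $p$ with respect to $\eta_p$ is the map $\eta_pC^\lambda:M\to M$, $\eta_pC^\lambda(x)=\gamma_{px}(\lambda)$, where $\gamma_{px}:[0,1]\to M$ is the length minimizing geodesic from $p$ to $x$ with $\gamma_{px}'(0)=\eta_p(x)$. A nonempty set $A\subseteq M$ is \emph{$p^\lambda$-convex with respect to $\eta_p$} if for any two points $x,y\in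 A$ there is a length minimizing geodesic $\gamma$ from $\eta_pC^\lambda(x)$ to $\eta_pC^\lambda(y)$ with $\gamma([0,1])\subseteq A$. \textbf{Theorem.} Let $A\subseteq M$ contain more than two points. Then $A$ is geodesically convex if and only if for every $p\in A$ there exists a direction function $\eta_p$ at $p$ such that $A$ is $p^\lambda$-convex with respect to $\eta_p$ for every $\lambda\in(0,1]$. -/

import Mathlib

open Set Bundle Manifold
open scoped ContDiff

namespace RadialConvexity

noncomputable section

variable {E : Type*} [NormedAddCommGroup E] [NormedSpace ℝ E]
  {M : Type*} [TopologicalSpace M] [ChartedSpace E M]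
  [RiemannianBundle (fun x : M => TangentSpace 𝓘(ℝ, E) x)]

/-- The coefficients `g_y(u, v)` of the Riemannian metric of `M` in the chart around `x₀`:
`y` is a point of the coordinate domain, `u` and `v` are coordinate vectors, and `g_y(u, v)` is the
inner product of the tangent vectors of `M` they represent. -/
def chartMetric (x₀ : M) (y u v : E) : ℝ :=
  inner ℝ
    (mfderiv 𝓘(ℝ, E) 𝓘(ℝ, E) (extChartAt 𝓘(ℝ, E) x₀).symm y u :
      TangentSpace 𝓘(ℝ, E) ((extChartAt 𝓘(ℝ, E) x₀).symm y))
    (mfderiv 𝓘(ℝ, E) 𝓘(ℝ, E) (extChartAt 𝓘(ℝ, E) x₀).symm y v :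
      TangentSpace 𝓘(ℝ, E) ((extChartAt 𝓘(ℝ, E) x₀).symm y))

/-- Christoffel symbols of the first kind of the Levi-Civita connection in the chart around `x₀`,
that is, `Γ(u, v; w) = g(∇_u v, w)` for constant coordinate fields `u`, `v`, `w`, given by
`(D_u g(v, w) + D_v g(u, w) - D_w g(u, v)) / 2`. -/
def christoffel (x₀ : M) (y u v w : E) : ℝ :=
  (fderiv ℝ (fun z => chartMetric x₀ z v w) y u
    + fderiv ℝ (fun z => chartMetric x₀ z u w) y v
    - fderiv ℝ (fun z => chartMetric x₀ z u v) y w) / 2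

/-- `γ`, restricted to `[0, 1]`, is a geodesic: it is of class `C^2` and `∇_{γ'} γ' = 0`. In every
chart, with `c` the coordinate expression of `γ`, the equation reads
`g(c'', w) + Γ(c', c'; w) = 0` for all `w`, which is
`c''^k + ∑ Γ^k_{ij} c'^i c'^j = 0` with the index `k` lowered by the metric.
(Derivatives at the end points are one-sided.) -/
def IsGeodesic (γ : ℝ → M) : Prop :=
  ContMDiffOn 𝓘(ℝ, ℝ) 𝓘(ℝ, E) 2 γ (Icc 0 1) ∧
  ∀ x₀ : M, ∀ t ∈ Icc (0 : ℝ) 1, γ t ∈ (chartAt E x₀).source →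
    ∀ w : E,
      let c : ℝ → E := fun s => extChartAt 𝓘(ℝ, E) x₀ (γ s)
      chartMetric x₀ (c t) (iteratedDerivWithin 2 c (Icc 0 1) t) w
        + christoffel x₀ (c t) (derivWithin c (Icc 0 1) t) (derivWithin c (Icc 0 1) t) w = 0

/-- `γ`, restricted to `[0, 1]`, is a length minimizing geodesic from `x` to `y`: its length is the
infimum of the lengths of the `C^1` paths from `x` to `y`. -/
structure IsMinimizingGeodesic (γ : ℝ → M) (x y : M) : Prop where
  isGeodesic : IsGeodesic (E := E) γ
  source : γ 0 = x
  target : γ 1 = y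
  length_eq : pathELength 𝓘(ℝ, E) γ 0 1 = riemannianEDist 𝓘(ℝ, E) x y

/-- `γ 0 = p` and `γ'(0) = v` (one-sided derivative on `[0, 1]`), as an equality in the tangent
bundle. -/
def HasInitialVelocity (γ : ℝ → M) (p : M) (v : TangentSpace 𝓘(ℝ, E) p) : Prop :=
  (⟨γ 0, mfderivWithin 𝓘(ℝ, ℝ) 𝓘(ℝ, E) γ (Icc 0 1) 0 (1 : ℝ)⟩ : TangentBundle 𝓘(ℝ, E) M) = ⟨p, v⟩

/-- The set `G_p^x` of the initial velocities of the length minimizing geodesics from `p` to `x`. -/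
def initialDirections (p x : M) : Set (TangentSpace 𝓘(ℝ, E) p) :=
  {v | ∃ γ : ℝ → M, IsMinimizingGeodesic (E := E) γ p x ∧ HasInitialVelocity (E := E) γ p v}

variable (E) in
/-- A direction function at `p`: a function `η_p : M → T_p M` with `η_p(x) ∈ G_p^x` for all `x`. -/
structure DirectionFunction (p : M) where
  toFun : M → TangentSpace 𝓘(ℝ, E) p
  mem_initialDirections : ∀ x : M, toFun x ∈ initialDirections (E := E) p x

/-- The length minimizing geodesic `γ_{px}` from `p` to `x` with `γ_{px}'(0) = η_p(x)`. On `[0, 1]`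
it is unique, since a geodesic is determined by its initial velocity. -/
def DirectionFunction.geodesic {p : M} (η : DirectionFunction E p) (x : M) : ℝ → M :=
  (η.mem_initialDirections x).choose

/-- The radial contraction `η_p C^r (x) = γ_{px}(r)` by the factor `r ∈ (0, 1]`, based at `p`. -/
def radialContraction {p : M} (η : DirectionFunction E p) (r : ℝ) (x : M) : M :=
  η.geodesic x r

variable (E) in
/-- `A` is geodesically convex: any two points of `A` are joined by a length minimizing geodesic
contained in `A`. -/
def IsGeodesicallyConvex (A : Set M) : Prop :=
  ∀ x ∈ A, ∀ y ∈ A, ∃ γ : ℝ → M, IsMinimizingGeodesic (E := E) γ x y ∧ ∀ t ∈ Icc (0 : ℝ) 1, γ t ∈ A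

/-- `A` is `p^r`-convex with respect to the direction function `η` at `p`. -/
def IsRadiallyConvex {p : M} (η : DirectionFunction E p) (r : ℝ) (A : Set M) : Prop :=
  A.Nonempty ∧ ∀ x ∈ A, ∀ y ∈ A, ∃ γ : ℝ → M,
    IsMinimizingGeodesic (E := E) γ (radialContraction η r x) (radialContraction η r y) ∧
      ∀ t ∈ Icc (0 : ℝ) 1, γ t ∈ A

end

end RadialConvexity

/-! For the converse the factor `1` suffices: contraction by `1` is the identity, so convexity based
at `x` already gives a minimizing geodesic inside `A` from `x` to `y`. For the direct implication,
at `p ∈ A`, let `η` select the direction of a minimizing geodesic inside `A` whenever the target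
lies in `A`. Contractions of points of `A` then stay in `A`, and geodesic convexity joins them.

Two theorems carry this argument. A direction function is defined on all of `M`, so points outside
`A` also need a minimizing geodesic: this is Hopf-Rinow (`exists_isMinimizingGeodesic`), the only
use of completeness. And `DirectionFunction.geodesic` knows only the initial velocity, so a geodesic
must be determined by it (`IsGeodesic.eqOn`), which follows from uniqueness for the geodesic
equation as an ODE.

Hopf-Rinow is obtained by the direct method. A complete locally compact length space is proper, and
Tychonoff's theorem yields a curve with `dist (γ s) (γ t) = dist p q * |t - s|`
(`HasApproxBetween.exists_geodesic`). In a chart this curve is a priori only Lipschitz, but it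
minimizes energy among Lipschitz perturbations with fixed end points. The first variation vanishes,
and the lemma of du Bois-Reymond makes the momentum `G (c, c')` an integral of the force almost
everywhere. Solving for `c'` shows that it is continuous, then `C^1`; differentiating the momentum
gives the geodesic equation (`IsMetricChart.exists_velocity`). Distance and metric are linked by
`IsMetricChart`: near `x` the distance is the norm of `G x` up to factors arbitrarily close to `1`.
-/

section

open Filter Topology MeasureTheory
open scoped NNReal

set_option maxSynthPendingDepth 3

/-! ### Shortest paths in complete locally compact length spaces -/

/-- A metric space in which points approximately between any two given points exist. -/
def HasApproxBetween (X : Type*) [PseudoMetricSpace X] : Prop :=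
  ∀ x y : X, ∀ s : ℝ, 0 ≤ s → s ≤ dist x y → ∀ ε > 0,
    ∃ z, dist x z ≤ s ∧ dist z y ≤ dist x y - s + ε

namespace HasApproxBetween

variable {X : Type*} [MetricSpace X]

lemma closedBall_subset_cthickening (hX : HasApproxBetween X) (p : X) {r δ : ℝ} (hr : 0 ≤ r)
    (hδ : 0 < δ) : Metric.closedBall p (r + δ) ⊆ Metric.thickening (2 * δ) (Metric.closedBall p r) := by
  intro x hx
  rw [Metric.mem_closedBall, dist_comm] at hx
  rw [Metric.mem_thickening_iff]
  by_cases hxr : dist p x ≤ r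
  · refine ⟨x, by rwa [Metric.mem_closedBall, dist_comm], by simpa using hδ⟩
  · obtain ⟨z, hz, hz'⟩ := hX p x r hr (not_le.1 hxr).le (δ / 2) (by positivity)
    refine ⟨z, by rwa [Metric.mem_closedBall, dist_comm], ?_⟩
    rw [dist_comm]
    linarith

/-- By local compactness a compact ball has a compact neighbourhood. It contains a thickening of the
ball, hence a slightly larger ball. -/
lemma isCompact_closedBall_add (hX : HasApproxBetween X) [LocallyCompactSpace X] {p : X} {r : ℝ}
    (hr : 0 ≤ r) (h : IsCompact (Metric.closedBall p r)) :
    ∃ δ > 0, IsCompact (Metric.closedBall p (r + δ)) := by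
  obtain ⟨K, hK, hsub⟩ := exists_compact_superset h
  obtain ⟨δ, hδ, hδK⟩ := h.exists_thickening_subset_open isOpen_interior hsub
  refine ⟨δ / 2, by positivity, hK.of_isClosed_subset Metric.isClosed_closedBall ?_⟩
  refine (hX.closedBall_subset_cthickening p hr (by positivity)).trans ?_
  rw [mul_div_cancel₀ _ two_ne_zero]
  exact hδK.trans interior_subset

/-- A finite `ε / 2`-net of a slightly smaller ball is an `ε`-net of the ball of radius `R`, because
the larger ball lies within `2 * δ ≤ ε / 2` of the smaller one. -/
lemma isCompact_closedBall_of_lt (hX : HasApproxBetween X) [CompleteSpace X] {p : X} {R : ℝ}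
    (hR : 0 < R) (h : ∀ r, 0 ≤ r → r < R → IsCompact (Metric.closedBall p r)) :
    IsCompact (Metric.closedBall p R) := by
  refine isCompact_iff_totallyBounded_isComplete.2 ⟨?_, Metric.isClosed_closedBall.isComplete⟩
  rw [Metric.totallyBounded_iff]
  intro ε hε
  set δ := min (ε / 4) (R / 2)
  have hδ : 0 < δ := by positivity
  have h1 : δ ≤ R / 2 := min_le_right _ _
  have h2 : δ ≤ ε / 4 := min_le_left _ _
  obtain ⟨t, ht, hcov⟩ := Metric.totallyBounded_iff.1
    (h (R - δ) (by linarith) (by linarith)).totallyBounded (ε / 2) (by positivity)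
  refine ⟨t, ht, fun x hx => ?_⟩
  have hx' : x ∈ Metric.closedBall p (R - δ + δ) := by simpa using hx
  obtain ⟨z, hz, hxz⟩ := Metric.mem_thickening_iff.1
    (hX.closedBall_subset_cthickening p (by linarith) hδ hx')
  obtain ⟨y, hy, hzy⟩ := mem_iUnion₂.1 (hcov hz)
  refine mem_iUnion₂.2 ⟨y, hy, ?_⟩
  rw [Metric.mem_ball] at *
  linarith [dist_triangle x z y]

/-- The Hopf-Rinow-Cohn-Vossen theorem: bounded closed sets are compact. -/
lemma properSpace (hX : HasApproxBetween X) [LocallyCompactSpace X] [CompleteSpace X] :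
    ProperSpace X := by
  refine ⟨fun p R => ?_⟩
  by_contra hR
  -- If some ball at `p` is not compact, let `sInf S` be the critical radius. The ball of that
  -- radius is a limit of compact ones, hence compact, and so is a slightly larger one, a
  -- contradiction.
  let S := {r : ℝ | 0 ≤ r ∧ ¬ IsCompact (Metric.closedBall p r)}
  have hRS : R ∈ S := by
    refine ⟨?_, hR⟩
    by_contra hneg
    rw [Metric.closedBall_eq_empty.2 (not_le.1 hneg)] at hR
    exact hR isCompact_empty
  have hbdd : BddBelow S := ⟨0, fun r hr => hr.1⟩
  have hlt : ∀ r, 0 ≤ r → r < sInf S → IsCompact (Metric.closedBall p r) := by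
    intro r h0 hr
    by_contra h
    exact (csInf_le hbdd (show r ∈ S from ⟨h0, h⟩)).not_gt hr
  have h0 : 0 ≤ sInf S := le_csInf ⟨R, hRS⟩ fun r hr => hr.1
  have hc : IsCompact (Metric.closedBall p (sInf S)) := by
    rcases h0.eq_or_lt with h | h
    · rw [← h, Metric.closedBall_zero]; exact isCompact_singleton
    · exact hX.isCompact_closedBall_of_lt h hlt
  obtain ⟨δ, hδ, hcδ⟩ := hX.isCompact_closedBall_add h0 hc
  obtain ⟨r, hr, hrδ⟩ := exists_lt_of_csInf_lt ⟨R, hRS⟩ (show sInf S < sInf S + δ by linarith)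
  exact hr.2 (hcδ.of_isClosed_subset Metric.isClosed_closedBall
    (Metric.closedBall_subset_closedBall hrδ.le))

/-- Properness removes the error `ε`: a point of the compact ball of radius `s` at `x` that is
nearest to `y` beats every approximate point. -/
lemma exists_between [ProperSpace X] (hX : HasApproxBetween X) (x y : X) {s : ℝ} (h0 : 0 ≤ s)
    (hs : s ≤ dist x y) : ∃ z, dist x z ≤ s ∧ dist z y ≤ dist x y - s := by
  obtain ⟨z, hz, hmin⟩ := (isCompact_closedBall x s).exists_isMinOn
    (Metric.nonempty_closedBall.2 h0) (f := fun z => dist z y) (by fun_prop)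
  refine ⟨z, by rwa [Metric.mem_closedBall, dist_comm] at hz, ?_⟩
  refine le_of_forall_pos_le_add fun ε hε => ?_
  obtain ⟨w, hw, hw'⟩ := hX x y s h0 hs ε hε
  exact (hmin (show w ∈ Metric.closedBall x s by rwa [Metric.mem_closedBall, dist_comm])).trans hw'

/-- Times are inserted in increasing order, so each new point only has to lie between the last one
and `q`. Only upper bounds are recorded: they are closed conditions, and the matching lower bounds
follow from the triangle inequality. -/
lemma exists_finite_geodesic [ProperSpace X] (hX : HasApproxBetween X) (p q : X) (T : Finset ℝ) :
    ∃ f : ℝ → X, (∀ s ∈ T, s ∈ Icc (0 : ℝ) 1 → dist p (f s) ≤ dist p q * s ∧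
        dist (f s) q ≤ dist p q * (1 - s)) ∧
      ∀ s ∈ T, ∀ t ∈ T, s ∈ Icc (0 : ℝ) 1 → t ∈ Icc (0 : ℝ) 1 → s ≤ t →
        dist (f s) (f t) ≤ dist p q * (t - s) := by
  induction T using Finset.induction_on_max with
  | empty => exact ⟨fun _ => p, by simp, by simp⟩
  | insert a T hT ih =>
    obtain ⟨f, hf1, hf2⟩ := ih
    by_cases ha : a ∈ Icc (0 : ℝ) 1
    swap
    · refine ⟨f, ?_, ?_⟩
      · intro s hs hs1
        rcases Finset.mem_insert.1 hs with rfl | hs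
        · exact absurd hs1 ha
        · exact hf1 s hs hs1
      · intro s hs t ht hs1 ht1
        rcases Finset.mem_insert.1 hs with rfl | hs
        · exact absurd hs1 ha
        rcases Finset.mem_insert.1 ht with rfl | ht
        · exact absurd ht1 ha
        exact hf2 s hs t ht hs1 ht1
    -- it suffices to find the new point
    suffices ∃ z, dist p z ≤ dist p q * a ∧ dist z q ≤ dist p q * (1 - a) ∧
        ∀ s ∈ T, s ∈ Icc (0 : ℝ) 1 → dist (f s) z ≤ dist p q * (a - s) by
      obtain ⟨z, hz1, hz2, hz3⟩ := this
      have hne : ∀ s ∈ T, s ≠ a := fun s hs => (hT s hs).ne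
      refine ⟨Function.update f a z, ?_, ?_⟩
      · intro s hs hs1
        rcases Finset.mem_insert.1 hs with rfl | hs
        · simpa using ⟨hz1, hz2⟩
        · simpa [hne s hs] using hf1 s hs hs1
      · intro s hs t ht hs1 ht1 hst
        rcases Finset.mem_insert.1 hs with rfl | hs'
        · rcases Finset.mem_insert.1 ht with rfl | ht'
          · simp
          · exact absurd hst (hT t ht').not_ge
        rcases Finset.mem_insert.1 ht with rfl | ht'
        · simpa [hne s hs'] using hz3 s hs' hs1
        · simpa [hne s hs', hne t ht'] using hf2 s hs' t ht' hs1 ht1 hst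
    -- The last earlier time in `[0, 1]` with its point, or time `0` with `p` if there is none.
    obtain ⟨m, x, hm0, hma, hpx, hxq, hx⟩ : ∃ m x, 0 ≤ m ∧ m ≤ a ∧ dist p x ≤ dist p q * m ∧
        dist x q ≤ dist p q * (1 - m) ∧
        ∀ s ∈ T, s ∈ Icc (0 : ℝ) 1 → dist (f s) x ≤ dist p q * (m - s) := by
      classical
      by_cases hne : (T.filter (· ∈ Icc (0 : ℝ) 1)).Nonempty
      · have hmem := Finset.max'_mem _ hne
        set m := (T.filter (· ∈ Icc (0 : ℝ) 1)).max' hne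
        obtain ⟨hmT, hm1⟩ := Finset.mem_filter.1 hmem
        refine ⟨m, f m, hm1.1, (hT m hmT).le, (hf1 m hmT hm1).1, (hf1 m hmT hm1).2, ?_⟩
        intro s hs hs1
        exact hf2 s hs m hmT hs1 hm1 (Finset.le_max' _ _ (Finset.mem_filter.2 ⟨hs, hs1⟩))
      · refine ⟨0, p, le_rfl, ha.1, by simp, by simp, fun s hs hs1 => ?_⟩
        exact absurd ⟨s, Finset.mem_filter.2 ⟨hs, hs1⟩⟩ hne
    have htri := dist_triangle p x q
    have hL : 0 ≤ dist p q := dist_nonneg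
    have hxq' : dist x q = dist p q * (1 - m) := by linarith
    have hpos : 0 ≤ dist p q * (a - m) := mul_nonneg hL (by linarith)
    obtain ⟨z, hxz, hzq⟩ := hX.exists_between x q hpos (by
      rw [hxq']; exact mul_le_mul_of_nonneg_left (by linarith [ha.2]) hL)
    refine ⟨z, ?_, ?_, fun s hs hs1 => ?_⟩
    · linarith [dist_triangle p x z]
    · linarith
    · linarith [dist_triangle (f s) x z, hx s hs hs1]

/-- In a complete locally compact length space any two points are joined by a shortest path,
parametrized proportionally to arc length. -/
theorem exists_geodesic (hX : HasApproxBetween X) [LocallyCompactSpace X] [CompleteSpace X]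
    (p q : X) : ∃ f : ℝ → X, f 0 = p ∧ f 1 = q ∧
      ∀ s ∈ Icc (0 : ℝ) 1, ∀ t ∈ Icc (0 : ℝ) 1, dist (f s) (f t) = dist p q * |t - s| := by
  have := hX.properSpace
  have hL : 0 ≤ dist p q := dist_nonneg
  -- Tychonoff: the conditions `C T` are closed in a product of compact balls, and any finitely many
  -- of them are implied by the condition for the union of their sets of times.
  let Y : Set (ℝ → X) := Set.pi univ fun _ => Metric.closedBall p (dist p q)
  have hY : IsCompact Y := isCompact_univ_pi fun _ => isCompact_closedBall _ _
  let C : Finset ℝ → Set (ℝ → X) := fun T => {f | (∀ s ∈ T, s ∈ Icc (0 : ℝ) 1 →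
      dist p (f s) ≤ dist p q * s ∧ dist (f s) q ≤ dist p q * (1 - s)) ∧
      ∀ s ∈ T, ∀ t ∈ T, s ∈ Icc (0 : ℝ) 1 → t ∈ Icc (0 : ℝ) 1 → s ≤ t →
        dist (f s) (f t) ≤ dist p q * (t - s)}
  have hC : ∀ T, IsClosed (C T) := by
    intro T
    simp only [C, ofPred_and, ofPred_forall]
    refine IsClosed.inter ?_ ?_
    · refine isClosed_iInter fun s => isClosed_iInter fun _ => isClosed_iInter fun _ => ?_
      exact (isClosed_le (by fun_prop) (by fun_prop)).inter
        (isClosed_le (by fun_prop) (by fun_prop))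
    · refine isClosed_iInter fun s => isClosed_iInter fun _ => isClosed_iInter fun t =>
        isClosed_iInter fun _ => isClosed_iInter fun _ => isClosed_iInter fun _ =>
        isClosed_iInter fun _ => isClosed_le (by fun_prop) (by fun_prop)
  have hmono : ∀ S T : Finset ℝ, S ⊆ T → C T ⊆ C S := fun S T hST f hf =>
    ⟨fun s hs => hf.1 s (hST hs), fun s hs t ht => hf.2 s (hST hs) t (hST ht)⟩
  obtain ⟨f, -, hf⟩ : (Y ∩ ⋂ T, C T).Nonempty := by
    classical
    refine hY.inter_iInter_nonempty C hC fun u => ?_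
    obtain ⟨g, hg⟩ := hX.exists_finite_geodesic p q (u.biUnion id)
    -- Values at irrelevant times are reset to `p` so that the function lies in `Y`.
    let g' : ℝ → X := fun s => if s ∈ u.biUnion id ∧ s ∈ Icc (0 : ℝ) 1 then g s else p
    have hg' : ∀ s ∈ u.biUnion id, s ∈ Icc (0 : ℝ) 1 → g' s = g s := fun s hs hs1 =>
      if_pos ⟨hs, hs1⟩
    refine ⟨g', ?_, ?_⟩
    · intro s _
      by_cases h : s ∈ u.biUnion id ∧ s ∈ Icc (0 : ℝ) 1
      · rw [hg' s h.1 h.2, Metric.mem_closedBall, dist_comm]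
        exact (hg.1 s h.1 h.2).1.trans (mul_le_of_le_one_right hL h.2.2)
      · rw [show g' s = p from if_neg h]
        exact Metric.mem_closedBall_self hL
    · have : g' ∈ C (u.biUnion id) := by
        refine ⟨fun s hs hs1 => ?_, fun s hs t ht hs1 ht1 => ?_⟩
        · rw [hg' s hs hs1]; exact hg.1 s hs hs1
        · rw [hg' s hs hs1, hg' t ht ht1]; exact hg.2 s hs t ht hs1 ht1
      exact mem_iInter₂.2 fun T hT => hmono T _ (Finset.subset_biUnion_of_mem id hT) this
  rw [mem_iInter] at hf
  have hp : ∀ s ∈ Icc (0 : ℝ) 1, dist p (f s) ≤ dist p q * s ∧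
      dist (f s) q ≤ dist p q * (1 - s) := fun s hs => (hf {s}).1 s (by simp) hs
  have hle : ∀ s ∈ Icc (0 : ℝ) 1, ∀ t ∈ Icc (0 : ℝ) 1, s ≤ t →
      dist (f s) (f t) = dist p q * (t - s) := by
    intro s hs t ht hst
    refine le_antisymm ((hf {s, t}).2 s (by simp) t (by simp) hs ht hst) ?_
    have h1 := dist_triangle p (f s) q
    have h2 := dist_triangle (f s) (f t) q
    linarith [(hp s hs).1, (hp t ht).2]
  refine ⟨f, ?_, ?_, fun s hs t ht => ?_⟩
  · simpa [eq_comm] using (hp 0 (by simp)).1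
  · simpa using (hp 1 (by simp)).2
  · rcases le_total s t with h | h
    · rw [hle s hs t ht h, abs_of_nonneg (by linarith)]
    · rw [dist_comm, hle t ht s hs h, abs_of_nonpos (by linarith), neg_sub]

end HasApproxBetween

/-! ### Lipschitz functions and the lemma of du Bois-Reymond -/

lemma intervalIntegrable_of_bounded {F : Type*} [NormedAddCommGroup F] {f : ℝ → F} {C : ℝ}
    (hf : StronglyMeasurable f) (hC : ∀ t, ‖f t‖ ≤ C) (a b : ℝ) :
    IntervalIntegrable f volume a b := by
  rw [intervalIntegrable_iff]
  exact Measure.integrableOn_of_bounded (M := C) (by simp) hf.aestronglyMeasurable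
    (Eventually.of_forall hC)

lemma intervalIntegrable_mul_of_bounded {f g : ℝ → ℝ} {C D : ℝ} (hf : StronglyMeasurable f)
    (hg : StronglyMeasurable g) (hC : ∀ t, ‖f t‖ ≤ C) (hD : ∀ t, ‖g t‖ ≤ D) (a b : ℝ) :
    IntervalIntegrable (fun t => f t * g t) volume a b := by
  refine intervalIntegrable_of_bounded (hf.mul hg) (C := C * D) (fun t => ?_) a b
  rw [Pi.mul_apply, norm_mul]
  exact mul_le_mul (hC t) (hD t) (norm_nonneg _) ((norm_nonneg _).trans (hC t))

lemma lipschitzWith_integral_of_bounded {F : Type*} [NormedAddCommGroup F] [NormedSpace ℝ F]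
    {f : ℝ → F} {C : ℝ≥0} (hf : StronglyMeasurable f) (hC : ∀ t, ‖f t‖ ≤ C) (a : ℝ) :
    LipschitzWith C (fun t => ∫ s in a..t, f s) := by
  refine LipschitzWith.of_dist_le_mul fun s t => ?_
  rw [dist_eq_norm, intervalIntegral.integral_interval_sub_left
    (intervalIntegrable_of_bounded hf hC _ _) (intervalIntegrable_of_bounded hf hC _ _),
    Real.dist_eq]
  exact intervalIntegral.norm_integral_le_of_norm_le_const fun x _ => hC x

lemma ae_hasDerivAt_integral_of_bounded {F : Type*} [NormedAddCommGroup F] [NormedSpace ℝ F]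
    [CompleteSpace F] {f : ℝ → F} {C : ℝ} (hf : StronglyMeasurable f) (hC : ∀ t, ‖f t‖ ≤ C)
    (a : ℝ) : ∀ᵐ t, HasDerivAt (fun t => ∫ s in a..t, f s) (f t) t := by
  have hloc : LocallyIntegrable f volume := by
    intro x
    refine ⟨Icc (x - 1) (x + 1), Icc_mem_nhds (by linarith) (by linarith), ?_⟩
    exact Measure.integrableOn_of_bounded (M := C) (by simp) hf.aestronglyMeasurable
      (Eventually.of_forall hC)
  filter_upwards [LocallyIntegrable.ae_hasDerivAt_integral hloc] with t ht using ht a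

/-- The fundamental theorem of calculus for Lipschitz functions. -/
lemma LipschitzWith.integral_deriv_eq_sub {F : Type*} [NormedAddCommGroup F] [NormedSpace ℝ F]
    [FiniteDimensional ℝ F] {f : ℝ → F} {K : ℝ≥0} (hf : LipschitzWith K f) (a b : ℝ) :
    ∫ t in a..b, deriv f t = f b - f a := by
  have : CompleteSpace F := FiniteDimensional.complete ℝ F
  have hm := stronglyMeasurable_deriv f
  have hb : ∀ t, ‖deriv f t‖ ≤ K := fun t => norm_deriv_le_of_lipschitz hf
  -- The difference is Lipschitz, hence absolutely continuous, with derivative zero almost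
  -- everywhere, so it is constant.
  have hlip : LipschitzWith (K + K) (fun t => (∫ s in a..t, deriv f s) - f t) :=
    (lipschitzWith_integral_of_bounded hm hb a).sub hf
  obtain ⟨C, hC⟩ := ((hlip.lipschitzOnWith (s := uIcc a b)).absolutelyContinuousOnInterval
    ).const_of_ae_hasDerivAt_zero (by
      filter_upwards [ae_hasDerivAt_integral_of_bounded hm hb a, hf.ae_differentiableAt_real]
        with t h1 h2 _
      simpa using h1.fun_sub h2.hasDerivAt)
  have h1 := hC a (by simp)
  have h2 := hC b (by simp)
  simp only [intervalIntegral.integral_same, zero_sub] at h1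
  rw [← h1] at h2
  rw [sub_eq_iff_eq_add] at h2
  rw [h2]; abel

/-- The lemma of du Bois-Reymond. -/
theorem ae_eq_const_add_integral_of_forall_integral_eq_zero {a b : ℝ} (hab : a < b) {A B : ℝ → ℝ}
    {CA CB : ℝ} (hA : StronglyMeasurable A) (hB : StronglyMeasurable B) (hCA : ∀ t, ‖A t‖ ≤ CA)
    (hCB : ∀ t, ‖B t‖ ≤ CB)
    (h : ∀ (f : ℝ → ℝ) (K : ℝ≥0), LipschitzWith K f → (∀ t ∉ Ioo a b, f t = 0) →
      ∫ t in a..b, (A t * deriv f t + B t * f t) = 0) :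
    ∃ k : ℝ, ∀ᵐ t ∂volume.restrict (Ioc a b), A t = k + ∫ s in a..t, B s := by
  have hCB' : ∀ t, ‖B t‖ ≤ (Real.toNNReal CB : ℝ) := fun t => (hCB t).trans (Real.le_coe_toNNReal _)
  set Q : ℝ → ℝ := fun t => ∫ s in a..t, B s
  have hQ : LipschitzWith _ Q := lipschitzWith_integral_of_bounded hB hCB' a
  have hQd : ∀ᵐ t, HasDerivAt Q (B t) t := ae_hasDerivAt_integral_of_bounded hB hCB a
  have hR : StronglyMeasurable (fun t => A t - Q t) := hA.sub hQ.continuous.stronglyMeasurable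
  obtain ⟨CQ, hCQ⟩ := isCompact_Icc.exists_bound_of_continuousOn
    (hQ.continuous.continuousOn (s := Icc a b))
  -- With `k` the mean of `A - Q`, the function `g = A - Q - k`, cut off outside `[a, b]`, has
  -- integral zero. Its primitive `f` therefore vanishes at both ends and is an admissible test
  -- function.
  let k : ℝ := (b - a)⁻¹ * ∫ t in a..b, (A t - Q t)
  let g : ℝ → ℝ := (Icc a b).indicator fun t => A t - Q t - k
  have hg : StronglyMeasurable g := (hR.sub stronglyMeasurable_const).indicator measurableSet_Icc
  have hgC : ∀ t, ‖g t‖ ≤ (Real.toNNReal (CA + CQ + ‖k‖) : ℝ) := by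
    intro t
    refine le_trans ?_ (Real.le_coe_toNNReal _)
    by_cases ht : t ∈ Icc a b
    · rw [show g t = A t - Q t - k from indicator_of_mem ht _]
      exact (norm_sub_le _ _).trans (by
        gcongr; exact (norm_sub_le _ _).trans (add_le_add (hCA t) (hCQ t ht)))
    · rw [show g t = 0 from indicator_of_notMem ht _, norm_zero]
      have h1 := (norm_nonneg _).trans (hCA a)
      have h2 := (norm_nonneg _).trans (hCQ a (left_mem_Icc.2 hab.le))
      positivity
  have hRint : IntervalIntegrable (fun t => A t - Q t) volume a b :=
    (intervalIntegrable_of_bounded hA hCA _ _).sub (hQ.continuous.intervalIntegrable _ _)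
  have hgint := fun x y => intervalIntegrable_of_bounded hg hgC x y
  have hgR : ∀ t ∈ uIcc a b, g t = A t - Q t - k := fun t ht => by
    rw [uIcc_of_le hab.le] at ht; exact indicator_of_mem ht _
  have hgzero : ∫ t in a..b, g t = 0 := by
    rw [intervalIntegral.integral_congr hgR, intervalIntegral.integral_sub hRint (by simp),
      intervalIntegral.integral_const, smul_eq_mul, mul_inv_cancel_left₀ (by linarith), sub_self]
  let f : ℝ → ℝ := fun t => ∫ s in a..t, g s
  have hf : LipschitzWith _ f := lipschitzWith_integral_of_bounded hg hgC a
  have hfd : ∀ᵐ t, HasDerivAt f (g t) t := ae_hasDerivAt_integral_of_bounded hg hgC a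
  have hf0 : ∀ t ∉ Ioo a b, f t = 0 := by
    intro t ht
    rcases le_or_gt t a with hta | hta
    · refine intervalIntegral.integral_zero_ae ?_
      filter_upwards [show ∀ᵐ s : ℝ, s ≠ a from by simp [ae_iff]] with s hs hs'
      rw [uIoc_of_ge hta] at hs'
      exact indicator_of_notMem (fun h => hs (le_antisymm hs'.2 h.1)) _
    · have htb : b ≤ t := not_lt.1 fun h => ht ⟨hta, h⟩
      have hz : ∫ s in b..t, g s = 0 := by
        refine intervalIntegral.integral_zero_ae (Eventually.of_forall fun s hs => ?_)
        rw [uIoc_of_le htb] at hs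
        exact indicator_of_notMem (fun h => hs.1.not_ge h.2) _
      show ∫ s in a..t, g s = 0
      rw [← intervalIntegral.integral_add_adjacent_intervals (hgint a b) (hgint b t), hgzero, hz,
        add_zero]
  have hfa : f a = 0 := hf0 a (by simp)
  have hfb : f b = 0 := hf0 b (by simp)
  have hparts := (hQ.lipschitzOnWith (s := uIcc a b)).absolutelyContinuousOnInterval
    |>.integral_mul_deriv_eq_deriv_mul (hf.lipschitzOnWith (s := uIcc a b)
      ).absolutelyContinuousOnInterval
  rw [hfa, hfb, mul_zero, mul_zero, sub_zero, zero_sub] at hparts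
  have e1 : ∫ t in a..b, Q t * deriv f t = ∫ t in a..b, Q t * g t :=
    intervalIntegral.integral_congr_ae (by filter_upwards [hfd] with t ht _; rw [ht.deriv])
  have e2 : ∫ t in a..b, deriv Q t * f t = ∫ t in a..b, B t * f t :=
    intervalIntegral.integral_congr_ae (by filter_upwards [hQd] with t ht _; rw [ht.deriv])
  have e3 : ∫ t in a..b, (A t * deriv f t + B t * f t) = ∫ t in a..b, (A t * g t + B t * f t) :=
    intervalIntegral.integral_congr_ae (by filter_upwards [hfd] with t ht _; rw [ht.deriv])
  have iA : IntervalIntegrable (fun t => A t * g t) volume a b :=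
    intervalIntegrable_mul_of_bounded hA hg hCA hgC _ _
  have iB : IntervalIntegrable (fun t => B t * f t) volume a b :=
    (intervalIntegrable_of_bounded hB hCB _ _).mul_continuousOn hf.continuous.continuousOn
  have iQ : IntervalIntegrable (fun t => Q t * g t) volume a b :=
    (hgint a b).continuousOn_mul hQ.continuous.continuousOn
  have h0 := h f _ hf hf0
  rw [e3, intervalIntegral.integral_add iA iB] at h0
  rw [e1, e2] at hparts
  -- Integration by parts turns the hypothesis into `∫ (A - Q) * g = 0`; since `g` has mean zero,
  -- `k` may be subtracted from the first factor.
  have hsq : ∫ t in a..b, g t * g t = 0 := by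
    have : ∫ t in a..b, g t * g t = ∫ t in a..b, (A t * g t - Q t * g t - k * g t) :=
      intervalIntegral.integral_congr fun t ht => by
        linear_combination g t * hgR t ht
    rw [this, intervalIntegral.integral_sub (iA.sub iQ) ((hgint a b).const_mul k),
      intervalIntegral.integral_sub iA iQ, intervalIntegral.integral_const_mul, hgzero]
    linarith
  have hsqint : IntervalIntegrable (fun t => g t * g t) volume a b :=
    intervalIntegrable_mul_of_bounded hg hg hgC hgC _ _
  refine ⟨k, ?_⟩
  have hae := (intervalIntegral.integral_eq_zero_iff_of_le_of_nonneg_ae hab.le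
    (Eventually.of_forall fun t => mul_self_nonneg (g t)) hsqint).1 hsq
  filter_upwards [hae, ae_restrict_mem measurableSet_Ioc] with t ht htm
  have : g t = 0 := mul_self_eq_zero.1 ht
  rw [hgR t (by rw [uIcc_of_le hab.le]; exact Ioc_subset_Icc_self htm)] at this
  show A t = k + Q t
  linarith

/-! ### Metrics in a chart and the distance they induce -/

/-- `G` is a smooth Riemannian metric on the open subset `U` of `E`, and `ψ` maps `U` to a metric
space in such a way that the distance is infinitesimally given by `G`. -/
structure IsMetricChart {E X : Type*} [NormedAddCommGroup E] [NormedSpace ℝ E]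
    [PseudoMetricSpace X] (U : Set E) (G : E → E →L[ℝ] E →L[ℝ] ℝ) (ψ : E → X) : Prop where
  isOpen : IsOpen U
  contDiffOn : ContDiffOn ℝ ∞ G U
  symm : ∀ x ∈ U, ∀ u v, G x u v = G x v u
  pos : ∀ x ∈ U, ∀ v, v ≠ 0 → 0 < G x v v
  sqrt_le_dist : ∀ x ∈ U, ∀ K > 1, ∀ᶠ p in 𝓝 (x, x),
    √(G x (p.2 - p.1) (p.2 - p.1)) ≤ K * dist (ψ p.1) (ψ p.2)
  dist_le_sqrt : ∀ x ∈ U, ∀ K > 1, ∀ᶠ p in 𝓝 (x, x),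
    dist (ψ p.1) (ψ p.2) ≤ K * √(G x (p.2 - p.1) (p.2 - p.1))

section Form

variable {E : Type*} [NormedAddCommGroup E] [NormedSpace ℝ E] [FiniteDimensional ℝ E]
  {B : E →L[ℝ] E →L[ℝ] ℝ}

lemma exists_coercive_of_pos (hB : ∀ v, v ≠ 0 → 0 < B v v) :
    ∃ m > 0, ∀ v, m * ‖v‖ ^ 2 ≤ B v v := by
  have hcont : Continuous fun v => B v v := by fun_prop
  have hscale : ∀ (r : ℝ) v, B (r • v) (r • v) = r ^ 2 * B v v := fun r v => by
    simp only [map_smul, smul_apply, smul_eq_mul]; ring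
  rcases (Metric.sphere (0 : E) 1).eq_empty_or_nonempty with h | h
  · refine ⟨1, one_pos, fun v => ?_⟩
    by_cases hv : v = 0
    · simp [hv]
    · have : ‖v‖⁻¹ • v ∈ Metric.sphere (0 : E) 1 := by
        simp [norm_smul, norm_ne_zero_iff.2 hv]
      simp [h] at this
  · have : ProperSpace E := FiniteDimensional.proper ℝ E
    obtain ⟨w, hw, hmin⟩ := (isCompact_sphere (0 : E) 1).exists_isMinOn h hcont.continuousOn
    have hw0 : w ≠ 0 := fun h0 => by simp [h0] at hw
    refine ⟨B w w, hB w hw0, fun v => ?_⟩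
    by_cases hv : v = 0
    · simp [hv]
    · have hn := norm_ne_zero_iff.2 hv
      have hmem : ‖v‖⁻¹ • v ∈ Metric.sphere (0 : E) 1 := by simp [norm_smul, hn]
      have h1 : B w w ≤ B (‖v‖⁻¹ • v) (‖v‖⁻¹ • v) := hmin hmem
      rw [hscale, inv_pow, ← div_eq_inv_mul, le_div_iff₀ (by positivity)] at h1
      exact h1

lemma isInvertible_of_pos (hB : ∀ v, v ≠ 0 → 0 < B v v) : B.IsInvertible := by
  have hinj : Function.Injective (B : E →ₗ[ℝ] E →L[ℝ] ℝ) := by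
    rw [← LinearMap.ker_eq_bot, LinearMap.ker_eq_bot']
    intro v hv
    by_contra h
    have h1 : B v = 0 := hv
    have h2 := hB v h
    simp [h1] at h2
  have hfr : Module.finrank ℝ E = Module.finrank ℝ (E →L[ℝ] ℝ) := by
    rw [← (LinearMap.toContinuousLinearMap (𝕜 := ℝ) (E := E) (F' := ℝ)).finrank_eq]
    exact (Subspace.dual_finrank_eq (K := ℝ) (V := E)).symm
  refine ⟨(LinearEquiv.ofInjectiveOfFinrankEq _ hinj hfr).toContinuousLinearEquiv, ?_⟩
  ext v w
  rfl

end Form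

namespace IsMetricChart

variable {E X : Type*} [NormedAddCommGroup E] [NormedSpace ℝ E]
  [PseudoMetricSpace X] {U : Set E} {G : E → E →L[ℝ] E →L[ℝ] ℝ} {ψ : E → X}

lemma contDiffAt (h : IsMetricChart U G ψ) {x : E} (hx : x ∈ U) : ContDiffAt ℝ ∞ G x :=
  h.contDiffOn.contDiffAt (h.isOpen.mem_nhds hx)

lemma nonneg (h : IsMetricChart U G ψ) {x : E} (hx : x ∈ U) (v : E) : 0 ≤ G x v v := by
  by_cases hv : v = 0
  · simp [hv]
  · exact (h.pos x hx v hv).le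

lemma differentiableAt (h : IsMetricChart U G ψ) {x : E} (hx : x ∈ U) : DifferentiableAt ℝ G x :=
  (h.contDiffAt hx).differentiableAt (by simp)

lemma contDiffAt_fderiv (h : IsMetricChart U G ψ) {x : E} (hx : x ∈ U) :
    ContDiffAt ℝ ∞ (fderiv ℝ G) x :=
  (h.contDiffAt hx).fderiv_right (m := ∞) (by simp)

lemma continuousOn_fderiv (h : IsMetricChart U G ψ) : ContinuousOn (fderiv ℝ G) U :=
  fun _ hx => (h.contDiffAt_fderiv hx).continuousAt.continuousWithinAt

/-- The speed of a curve which is `L`-Lipschitz for the distance is at most `L`. -/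
lemma apply_deriv_le (h : IsMetricChart U G ψ) {c : ℝ → E} {v : E} {t L : ℝ} (hL : 0 ≤ L)
    (hc : HasDerivAt c v t) (ht : c t ∈ U)
    (hd : ∀ᶠ s in 𝓝[>] t, dist (ψ (c t)) (ψ (c s)) ≤ L * |s - t|) : G (c t) v v ≤ L ^ 2 := by
  -- Right difference quotients give the bound up to the distortion `K` of the chart, which then
  -- tends to `1`.
  have key : ∀ K > 1, G (c t) v v ≤ K ^ 2 * L ^ 2 := by
    intro K hK
    have hsl : Tendsto (slope c t) (𝓝[>] t) (𝓝 v) :=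
      (hasDerivAt_iff_tendsto_slope.1 hc).mono_left (nhdsWithin_mono _ fun s hs => ne_of_gt hs)
    have hlim : Tendsto (fun s => G (c t) (slope c t s) (slope c t s)) (𝓝[>] t)
        (𝓝 (G (c t) v v)) :=
      ((by fun_prop : Continuous fun u => G (c t) u u).tendsto v).comp hsl
    have hct : Tendsto (fun s => (c t, c s)) (𝓝[>] t) (𝓝 (c t, c t)) :=
      (tendsto_const_nhds.prodMk_nhds hc.continuousAt.tendsto).mono_left nhdsWithin_le_nhds
    refine le_of_tendsto hlim ?_
    filter_upwards [hd, hct.eventually (h.sqrt_le_dist _ ht K hK), self_mem_nhdsWithin]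
      with s hs1 hs2 hs3
    have hpos : 0 < s - t := sub_pos.2 hs3
    have h1 : √(G (c t) (c s - c t) (c s - c t)) ≤ K * (L * (s - t)) := by
      rw [abs_of_pos hpos] at hs1
      exact hs2.trans (by gcongr)
    rw [Real.sqrt_le_left (by positivity)] at h1
    simp only [slope, vsub_eq_sub, map_smul, smul_apply, smul_eq_mul]
    rw [← mul_assoc, ← sq, inv_pow, ← div_eq_inv_mul, div_le_iff₀ (by positivity)]
    linarith
  have hlim : Tendsto (fun K : ℝ => K ^ 2 * L ^ 2) (𝓝[>] 1) (𝓝 (1 ^ 2 * L ^ 2)) :=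
    ((by fun_prop : Continuous fun K : ℝ => K ^ 2 * L ^ 2).tendsto 1).mono_left nhdsWithin_le_nhds
  rw [one_pow, one_mul] at hlim
  exact ge_of_tendsto hlim (by filter_upwards [self_mem_nhdsWithin] with K hK using key K hK)

/-- The infinitesimal form of "distance is at most length": by the triangle inequality, increments
of the distance to `p` are bounded by the distance between nearby points of the curve, hence by `K`
times their norm difference for `G (c t)`; then `K` tends to `1`. -/
lemma deriv_dist_le (h : IsMetricChart U G ψ) {c : ℝ → E} {v : E} {t f' : ℝ} {p : X}
    (hc : HasDerivAt c v t) (ht : c t ∈ U) (hf : HasDerivAt (fun s => dist p (ψ (c s))) f' t) :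
    f' ≤ √(G (c t) v v) := by
  have key : ∀ K > 1, f' ≤ K * √(G (c t) v v) := by
    intro K hK
    have hsl : Tendsto (slope c t) (𝓝[>] t) (𝓝 v) :=
      (hasDerivAt_iff_tendsto_slope.1 hc).mono_left (nhdsWithin_mono _ fun s hs => ne_of_gt hs)
    have hsf : Tendsto (slope (fun s => dist p (ψ (c s))) t) (𝓝[>] t) (𝓝 f') :=
      (hasDerivAt_iff_tendsto_slope.1 hf).mono_left (nhdsWithin_mono _ fun s hs => ne_of_gt hs)
    have hlim : Tendsto (fun s => K * √(G (c t) (slope c t s) (slope c t s))) (𝓝[>] t)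
        (𝓝 (K * √(G (c t) v v))) :=
      ((by fun_prop : Continuous fun u => K * √(G (c t) u u)).tendsto v).comp hsl
    have hct : Tendsto (fun s => (c t, c s)) (𝓝[>] t) (𝓝 (c t, c t)) :=
      (tendsto_const_nhds.prodMk_nhds hc.continuousAt.tendsto).mono_left nhdsWithin_le_nhds
    refine le_of_tendsto_of_tendsto hsf hlim ?_
    filter_upwards [hct.eventually (h.dist_le_sqrt _ ht K hK), self_mem_nhdsWithin] with s hs1 hs3
    have hpos : 0 < s - t := sub_pos.2 hs3
    have h1 : √(G (c t) (c s - c t) (c s - c t)) =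
        (s - t) * √(G (c t) (slope c t s) (slope c t s)) := by
      have hs : c s - c t = (s - t) • slope c t s := (sub_smul_slope c t s).symm
      rw [hs]
      generalize slope c t s = u
      simp only [map_smul, smul_apply, smul_eq_mul]
      rw [← mul_assoc, Real.sqrt_mul (by positivity), Real.sqrt_mul_self hpos.le]
    rw [h1] at hs1
    rw [slope_def_field, div_le_iff₀ hpos]
    linarith [dist_triangle p (ψ (c t)) (ψ (c s))]
  have hlim : Tendsto (fun K : ℝ => K * √(G (c t) v v)) (𝓝[>] 1) (𝓝 (1 * √(G (c t) v v))) :=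
    ((by fun_prop : Continuous fun K : ℝ => K * √(G (c t) v v)).tendsto 1).mono_left
      nhdsWithin_le_nhds
  rw [one_mul] at hlim
  exact ge_of_tendsto hlim (by filter_upwards [self_mem_nhdsWithin] with K hK using key K hK)

end IsMetricChart

/-- A set on which a Riemannian metric, its derivative and the distortion of a chart are bounded. -/
structure IsMetricBox {E X : Type*} [NormedAddCommGroup E] [NormedSpace ℝ E]
    [PseudoMetricSpace X] (U : Set E) (G : E → E →L[ℝ] E →L[ℝ] ℝ) (ψ : E → X) (S : Set E)
    (C : ℝ≥0) : Prop where
  subset : S ⊆ U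
  norm_le : ∀ y ∈ S, ‖G y‖ ≤ C
  norm_fderiv_le : ∀ y ∈ S, ‖fderiv ℝ G y‖ ≤ C
  dist_image_le : ∀ y ∈ S, ∀ z ∈ S, dist (ψ y) (ψ z) ≤ C * dist y z
  dist_le : ∀ y ∈ S, ∀ z ∈ S, dist y z ≤ C * dist (ψ y) (ψ z)

section Trilinear

variable {E : Type*} [NormedAddCommGroup E] [NormedSpace ℝ E]

lemma continuous_bilinear_apply :
    Continuous fun p : (E →L[ℝ] E →L[ℝ] ℝ) × E × E => p.1 p.2.1 p.2.2 := by
  fun_prop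

lemma abs_apply_apply_le {B : E →L[ℝ] E →L[ℝ] ℝ} {u v : E} {b k l : ℝ} (hB : ‖B‖ ≤ b)
    (hu : ‖u‖ ≤ k) (hv : ‖v‖ ≤ l) : ‖B u v‖ ≤ b * k * l :=
  (ContinuousLinearMap.le_of_opNorm_le_of_le _ (ContinuousLinearMap.le_of_opNorm_le_of_le _ hB hu)
    hv)

/-- The covector `w ↦ D w v v`. -/
noncomputable def trilinearForce (D : E →L[ℝ] E →L[ℝ] E →L[ℝ] ℝ) (v : E) : E →L[ℝ] ℝ :=
  (D.flip v).flip v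

@[simp] lemma trilinearForce_apply (D : E →L[ℝ] E →L[ℝ] E →L[ℝ] ℝ) (v w : E) :
    trilinearForce D v w = D w v v := rfl

lemma continuous_trilinearForce :
    Continuous fun p : (E →L[ℝ] E →L[ℝ] E →L[ℝ] ℝ) × E => trilinearForce p.1 p.2 := by
  have h1 : Continuous fun p : (E →L[ℝ] E →L[ℝ] E →L[ℝ] ℝ) × E => p.1.flip p.2 :=
    ((ContinuousLinearMap.flipₗᵢ ℝ E E (E →L[ℝ] ℝ)).continuous.comp continuous_fst).clm_apply
      continuous_snd
  exact ((ContinuousLinearMap.flipₗᵢ ℝ E E ℝ).continuous.comp h1).clm_apply continuous_snd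

lemma norm_trilinearForce_le (D : E →L[ℝ] E →L[ℝ] E →L[ℝ] ℝ) (v : E) :
    ‖trilinearForce D v‖ ≤ ‖D‖ * ‖v‖ * ‖v‖ :=
  (ContinuousLinearMap.le_opNorm _ _).trans (by
    rw [ContinuousLinearMap.opNorm_flip]
    gcongr
    exact (ContinuousLinearMap.le_opNorm _ _).trans (by rw [ContinuousLinearMap.opNorm_flip]))

end Trilinear

namespace IsMetricChart

variable {E X : Type*} [NormedAddCommGroup E] [NormedSpace ℝ E]
  [PseudoMetricSpace X] {U : Set E} {G : E → E →L[ℝ] E →L[ℝ] ℝ} {ψ : E → X}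

/-- Continuity bounds `G` and its derivative. The comparison with `K = 2`, together with boundedness
and coercivity of `G x`, makes `ψ` bi-Lipschitz near `x`. -/
lemma exists_isMetricBox [FiniteDimensional ℝ E] (h : IsMetricChart U G ψ) {x : E} (hx : x ∈ U) :
    ∃ ρ > 0, ∃ C : ℝ≥0, IsMetricBox U G ψ (Metric.closedBall x ρ) C := by
  obtain ⟨m, hm, hmv⟩ := exists_coercive_of_pos (h.pos x hx)
  have hG := (h.contDiffAt hx).continuousAt.norm.eventually_lt continuousAt_const
    (lt_add_one ‖G x‖)
  have hDG := (h.contDiffAt_fderiv hx).continuousAt.norm.eventually_lt continuousAt_const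
    (lt_add_one ‖fderiv ℝ G x‖)
  obtain ⟨r, hr, hball⟩ := Metric.eventually_nhds_iff_ball.1
    ((h.isOpen.eventually_mem hx).and (hG.and hDG))
  obtain ⟨r', hr', hball'⟩ := Metric.eventually_nhds_iff_ball.1
    ((h.sqrt_le_dist x hx 2 one_lt_two).and (h.dist_le_sqrt x hx 2 one_lt_two))
  let ρ := min r r' / 2
  have hρ : 0 < ρ := by positivity
  have hρr : ρ < r := (half_lt_self (by positivity)).trans_le (min_le_left _ _)
  have hρr' : ρ < r' := (half_lt_self (by positivity)).trans_le (min_le_right _ _)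
  let C : ℝ := max (max (‖G x‖ + 1) (‖fderiv ℝ G x‖ + 1)) (max (2 * √‖G x‖) (2 * (√m)⁻¹))
  have hC0 : 0 ≤ C := le_max_of_le_left (le_max_of_le_left (by positivity))
  have hsub : Metric.closedBall x ρ ⊆ Metric.ball x r := Metric.closedBall_subset_ball hρr
  have hpair : ∀ y ∈ Metric.closedBall x ρ, ∀ z ∈ Metric.closedBall x ρ,
      (y, z) ∈ Metric.ball (x, x) r' := fun y hy z hz => by
    rw [← ball_prod_same]
    exact ⟨Metric.closedBall_subset_ball hρr' hy, Metric.closedBall_subset_ball hρr' hz⟩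
  refine ⟨ρ, hρ, ⟨C, hC0⟩, fun y hy => (hball y (hsub hy)).1, fun y hy => ?_, fun y hy => ?_,
    fun y hy z hz => ?_, fun y hy z hz => ?_⟩
  · exact (hball y (hsub hy)).2.1.le.trans ((le_max_left _ _).trans (le_max_left _ _))
  · exact (hball y (hsub hy)).2.2.le.trans ((le_max_right _ _).trans (le_max_left _ _))
  · have h1 := (hball' _ (hpair y hy z hz)).2
    refine h1.trans ?_
    have h2 : √(G x (z - y) (z - y)) ≤ √‖G x‖ * dist y z := by
      rw [← Real.sqrt_sq (dist_nonneg (x := y) (y := z)), ← Real.sqrt_mul (norm_nonneg _),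
        dist_comm, dist_eq_norm]
      refine Real.sqrt_le_sqrt ((le_abs_self _).trans ?_)
      exact (abs_apply_apply_le le_rfl le_rfl le_rfl).trans (by rw [mul_assoc, sq])
    calc 2 * √(G x (z - y) (z - y)) ≤ 2 * √‖G x‖ * dist y z := by linarith
      _ ≤ C * dist y z := by
        gcongr; exact (le_max_left _ _).trans (le_max_right _ _)
  · have h1 := (hball' _ (hpair y hy z hz)).1
    have h2 : √m * dist y z ≤ √(G x (z - y) (z - y)) := by
      rw [← Real.sqrt_sq (dist_nonneg (x := y) (y := z)), ← Real.sqrt_mul hm.le,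
        dist_comm, dist_eq_norm]
      exact Real.sqrt_le_sqrt (hmv _)
    have hsm : 0 < √m := Real.sqrt_pos.2 hm
    calc dist y z ≤ 2 * (√m)⁻¹ * dist (ψ y) (ψ z) := by
          rw [mul_comm 2, mul_assoc, ← div_eq_inv_mul, le_div_iff₀ hsm]
          linarith
      _ ≤ C * dist (ψ y) (ψ z) := by
        gcongr; exact (le_max_right _ _).trans (le_max_right _ _)

variable {S : Set E} {C Kc : ℝ≥0} {c : ℝ → E}

lemma stronglyMeasurable_apply (h : IsMetricChart U G ψ) (hc : Continuous c) (hcU : ∀ t, c t ∈ U)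
    {u v : ℝ → E} (hu : StronglyMeasurable u) (hv : StronglyMeasurable v) :
    StronglyMeasurable fun t => G (c t) (u t) (v t) := by
  have hG : Continuous fun t => G (c t) := h.contDiffOn.continuousOn.comp_continuous hc hcU
  exact continuous_bilinear_apply.comp_stronglyMeasurable
    (hG.stronglyMeasurable.prodMk (hu.prodMk hv))

/-- The distance between the end points of a Lipschitz curve is at most its length. -/
lemma dist_le_integral [FiniteDimensional ℝ E] (h : IsMetricChart U G ψ)
    (hS : IsMetricBox U G ψ S C) (hc : LipschitzWith Kc c) (hcS : ∀ t, c t ∈ S) {a b : ℝ}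
    (hab : a ≤ b) :
    dist (ψ (c a)) (ψ (c b)) ≤ ∫ t in a..b, √(G (c t) (deriv c t) (deriv c t)) := by
  -- This function is Lipschitz, hence the integral of its derivative, which is at most the speed
  -- almost everywhere.
  set f : ℝ → ℝ := fun t => dist (ψ (c a)) (ψ (c t))
  have hf : LipschitzWith (C * Kc) f := by
    refine LipschitzWith.of_dist_le_mul fun s t => ?_
    rw [NNReal.coe_mul, mul_assoc]
    refine (dist_dist_dist_le_right _ _ _).trans ?_
    refine (hS.dist_image_le _ (hcS s) _ (hcS t)).trans ?_
    gcongr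
    exact hc.dist_le_mul s t
  have hfb : ∫ t in a..b, deriv f t = f b := by
    rw [hf.integral_deriv_eq_sub, show f a = 0 from dist_self _, sub_zero]
  show f b ≤ _
  rw [← hfb]
  refine intervalIntegral.integral_mono_ae hab
    (intervalIntegrable_of_bounded (stronglyMeasurable_deriv f)
      (fun t => norm_deriv_le_of_lipschitz hf) _ _) ?_ ?_
  · have hm := h.stronglyMeasurable_apply hc.continuous (fun t => hS.subset (hcS t))
      (stronglyMeasurable_deriv c) (stronglyMeasurable_deriv c)
    refine intervalIntegrable_of_bounded (C := √(C * Kc * Kc))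
      (Real.continuous_sqrt.comp_stronglyMeasurable hm) (fun t => ?_) _ _
    rw [Real.norm_of_nonneg (Real.sqrt_nonneg _)]
    exact Real.sqrt_le_sqrt ((le_abs_self _).trans (abs_apply_apply_le (hS.norm_le _ (hcS t))
      (norm_deriv_le_of_lipschitz hc) (norm_deriv_le_of_lipschitz hc)))
  · filter_upwards [hc.ae_differentiableAt_real, hf.ae_differentiableAt_real] with t h1 h2
    exact h.deriv_dist_le h1.hasDerivAt (hS.subset (hcS t)) h2.hasDerivAt

end IsMetricChart

/-! ### Energy and its first variation -/

namespace IsMetricChart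

variable {E X : Type*} [NormedAddCommGroup E] [NormedSpace ℝ E]
  [PseudoMetricSpace X] {U : Set E} {G : E → E →L[ℝ] E →L[ℝ] ℝ} {ψ : E → X}
  {S : Set E} {C Kc Kφ : ℝ≥0} {c φ : ℝ → E} {x : E} {ρ L a b : ℝ}

lemma intervalIntegrable_apply (h : IsMetricChart U G ψ) (hS : IsMetricBox U G ψ S C)
    (hc : Continuous c) (hcS : ∀ t, c t ∈ S) {u v : ℝ → E} (hu : StronglyMeasurable u)
    (hv : StronglyMeasurable v) {k l : ℝ} (hk : ∀ t, ‖u t‖ ≤ k) (hl : ∀ t, ‖v t‖ ≤ l) (a b : ℝ) :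
    IntervalIntegrable (fun t => G (c t) (u t) (v t)) volume a b :=
  intervalIntegrable_of_bounded (h.stronglyMeasurable_apply hc (fun t => hS.subset (hcS t)) hu hv)
    (fun t => abs_apply_apply_le (hS.norm_le _ (hcS t)) (hk t) (hl t)) _ _

/-- The energy of a curve which is `L`-Lipschitz for the distance is at most `L ^ 2 * (b - a)`. -/
lemma energy_le [FiniteDimensional ℝ E] (h : IsMetricChart U G ψ) (hS : IsMetricBox U G ψ S C) (hc : LipschitzWith Kc c)
    (hcS : ∀ t, c t ∈ S) (hab : a ≤ b) (hL : 0 ≤ L)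
    (hd : ∀ s ∈ Icc a b, ∀ t ∈ Icc a b, dist (ψ (c s)) (ψ (c t)) = L * |t - s|) :
    ∫ t in a..b, G (c t) (deriv c t) (deriv c t) ≤ L ^ 2 * (b - a) := by
  have hm := stronglyMeasurable_deriv c
  have hb : ∀ t, ‖deriv c t‖ ≤ Kc := fun t => norm_deriv_le_of_lipschitz hc
  calc ∫ t in a..b, G (c t) (deriv c t) (deriv c t) ≤ ∫ t in a..b, L ^ 2 := by
        refine intervalIntegral.integral_mono_ae_restrict hab
          (h.intervalIntegrable_apply hS hc.continuous hcS hm hm hb hb _ _) (by simp) ?_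
        rw [← restrict_Ioo_eq_restrict_Icc]
        filter_upwards [ae_restrict_of_ae hc.ae_differentiableAt_real,
          ae_restrict_mem measurableSet_Ioo] with t ht htm
        refine h.apply_deriv_le hL ht.hasDerivAt (hS.subset (hcS t)) ?_
        filter_upwards [Ioo_mem_nhdsGT htm.2] with s hs
        exact (hd t (Ioo_subset_Icc_self htm) s ⟨htm.1.le.trans hs.1.le, hs.2.le⟩).le
    _ = L ^ 2 * (b - a) := by simp [mul_comm]

/-- The energy of a curve is at least the square of the distance of its end points, divided by the
length of the interval. -/
lemma le_energy [FiniteDimensional ℝ E] (h : IsMetricChart U G ψ) (hS : IsMetricBox U G ψ S C) (hc : LipschitzWith Kc c)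
    (hcS : ∀ t, c t ∈ S) (hab : a ≤ b) (hL : 0 ≤ L)
    (hd : dist (ψ (c a)) (ψ (c b)) = L * (b - a)) :
    L ^ 2 * (b - a) ≤ ∫ t in a..b, G (c t) (deriv c t) (deriv c t) := by
  have hm := stronglyMeasurable_deriv c
  have hb : ∀ t, ‖deriv c t‖ ≤ Kc := fun t => norm_deriv_le_of_lipschitz hc
  have hint := h.intervalIntegrable_apply hS hc.continuous hcS hm hm hb hb a b
  have hnn : ∀ t, 0 ≤ G (c t) (deriv c t) (deriv c t) := fun t => h.nonneg (hS.subset (hcS t)) _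
  rcases hL.eq_or_lt with rfl | hL
  · simpa using intervalIntegral.integral_nonneg hab fun t _ => hnn t
  have h1 := h.dist_le_integral hS hc hcS hab
  -- In place of Cauchy-Schwarz, the pointwise bound `√e ≤ (e + L ^ 2) / (2 * L)`. It is sharp at
  -- speed `L` and needs `L ≠ 0`.
  have h2 : ∫ t in a..b, √(G (c t) (deriv c t) (deriv c t)) ≤
      ∫ t in a..b, (2 * L)⁻¹ * (G (c t) (deriv c t) (deriv c t) + L ^ 2) := by
    refine intervalIntegral.integral_mono_on hab ?_ ((hint.add (by simp)).const_mul _) ?_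
    · refine intervalIntegrable_of_bounded (C := √(C * Kc * Kc))
        (Real.continuous_sqrt.comp_stronglyMeasurable (h.stronglyMeasurable_apply hc.continuous
          (fun t => hS.subset (hcS t)) hm hm)) (fun t => ?_) _ _
      rw [Real.norm_of_nonneg (Real.sqrt_nonneg _)]
      exact Real.sqrt_le_sqrt ((le_abs_self _).trans
        (abs_apply_apply_le (hS.norm_le _ (hcS t)) (hb t) (hb t)))
    · intro t _
      rw [← div_eq_inv_mul, le_div_iff₀ (by positivity)]
      nlinarith [sq_nonneg (√(G (c t) (deriv c t) (deriv c t)) - L), Real.sq_sqrt (hnn t)]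
  rw [intervalIntegral.integral_const_mul, intervalIntegral.integral_add hint (by simp),
    intervalIntegral.integral_const, smul_eq_mul, ← div_eq_inv_mul, le_div_iff₀ (by positivity)]
    at h2
  rw [hd] at h1
  nlinarith

lemma hasDerivAt_energy_density (h : IsMetricChart U G ψ) {y u v w : E} {ε : ℝ}
    (hy : y + ε • u ∈ U) : HasDerivAt (fun ε : ℝ => G (y + ε • u) (v + ε • w) (v + ε • w))
      (fderiv ℝ G (y + ε • u) u (v + ε • w) (v + ε • w) + 2 * G (y + ε • u) (v + ε • w) w) ε := by
  have h1 : ∀ y u : E, HasDerivAt (fun ε : ℝ => y + ε • u) u ε := fun y u => by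
    simpa using ((hasDerivAt_id ε).smul_const u).const_add y
  have h2 := (h.differentiableAt hy).hasFDerivAt.comp_hasDerivAt ε (h1 y u)
  refine ((h2.clm_apply (h1 v w)).clm_apply (h1 v w)).congr_deriv ?_
  simp only [add_apply, Function.comp_apply]
  rw [h.symm _ hy w]
  ring

/-- The first variation of the energy vanishes at a shortest path. -/
theorem integral_first_variation_eq_zero [FiniteDimensional ℝ E] (h : IsMetricChart U G ψ) (hρ : 0 < ρ)
    (hS : IsMetricBox U G ψ (Metric.closedBall x ρ) C) (hc : LipschitzWith Kc c)
    (hcS : ∀ t, c t ∈ Metric.closedBall x (ρ / 2)) (hab : a ≤ b) (hL : 0 ≤ L)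
    (hd : ∀ s ∈ Icc a b, ∀ t ∈ Icc a b, dist (ψ (c s)) (ψ (c t)) = L * |t - s|)
    (hφ : LipschitzWith Kφ φ) (hφ0 : ∀ t ∉ Ioo a b, φ t = 0) :
    ∫ t in a..b, (fderiv ℝ G (c t) (φ t) (deriv c t) (deriv c t) +
      2 * G (c t) (deriv c t) (deriv φ t)) = 0 := by
  obtain ⟨R, hR0, hR⟩ : ∃ R > 0, ∀ t, ‖φ t‖ ≤ R := by
    obtain ⟨R, hR⟩ := isCompact_Icc.exists_bound_of_continuousOn
      (hφ.continuous.continuousOn (s := Icc a b))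
    refine ⟨max R 1, by positivity, fun t => ?_⟩
    by_cases ht : t ∈ Icc a b
    · exact (hR t ht).trans (le_max_left _ _)
    · rw [hφ0 t fun h => ht (Ioo_subset_Icc_self h), norm_zero]
      positivity
  have hδ : 0 < ρ / (2 * R) := by positivity
  -- Since `‖φ‖ ≤ R`, these `ε` move the curve by at most `ρ / 2`, so it stays in the box of radius
  -- `ρ`.
  set s : Set ℝ := Metric.ball 0 (ρ / (2 * R))
  have hs : s ∈ 𝓝 (0 : ℝ) := Metric.ball_mem_nhds _ hδ
  have habs : ∀ ε ∈ s, |ε| ≤ ρ / (2 * R) := fun ε hε => by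
    rw [Metric.mem_ball, dist_zero_right] at hε; exact hε.le
  have hmem : ∀ ε ∈ s, ∀ t, c t + ε • φ t ∈ Metric.closedBall x ρ := by
    intro ε hε t
    have h1 : ‖ε • φ t‖ ≤ ρ / 2 := by
      rw [norm_smul, Real.norm_eq_abs]
      calc |ε| * ‖φ t‖ ≤ ρ / (2 * R) * R := by gcongr; exacts [habs ε hε, hR t]
        _ = ρ / 2 := by field_simp
    have h2 := hcS t
    rw [Metric.mem_closedBall, dist_eq_norm] at h2 ⊢
    rw [add_sub_right_comm]
    linarith [norm_add_le (c t - x) (ε • φ t)]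
  have h0s : (0 : ℝ) ∈ s := Metric.mem_ball_self hδ
  have hcρ : ∀ t, c t ∈ Metric.closedBall x ρ := fun t => by simpa using hmem 0 h0s t
  have hlip : ∀ ε : ℝ, LipschitzWith (Kc + ‖ε‖₊ * Kφ) fun t => c t + ε • φ t := fun ε =>
    hc.add ((lipschitzWith_smul ε).comp hφ)
  have hmc := stronglyMeasurable_deriv c
  have hmφ := stronglyMeasurable_deriv φ
  have hbc : ∀ t, ‖deriv c t‖ ≤ Kc := fun t => norm_deriv_le_of_lipschitz hc
  have hbφ : ∀ t, ‖deriv φ t‖ ≤ Kφ := fun t => norm_deriv_le_of_lipschitz hφ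
  let V : ℝ → ℝ → E := fun ε t => deriv c t + ε • deriv φ t
  have hmV : ∀ ε, StronglyMeasurable (V ε) := fun ε => hmc.add (hmφ.const_smul ε)
  let k : ℝ := Kc + ρ / (2 * R) * Kφ
  have hbV : ∀ ε ∈ s, ∀ t, ‖V ε t‖ ≤ k := fun ε hε t => by
    refine (norm_add_le _ _).trans (add_le_add (hbc t) ?_)
    rw [norm_smul]
    exact mul_le_mul (habs ε hε) (hbφ t) (norm_nonneg _) hδ.le
  have hcont : ∀ ε : ℝ, Continuous fun t => c t + ε • φ t := fun ε => (hlip ε).continuous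
  let F : ℝ → ℝ → ℝ := fun ε t => G (c t + ε • φ t) (V ε t) (V ε t)
  let F' : ℝ → ℝ → ℝ := fun ε t => fderiv ℝ G (c t + ε • φ t) (φ t) (V ε t) (V ε t) +
    2 * G (c t + ε • φ t) (V ε t) (deriv φ t)
  have hmF : ∀ ε ∈ s, StronglyMeasurable (F ε) := fun ε hε =>
    h.stronglyMeasurable_apply (hcont ε) (fun t => hS.subset (hmem ε hε t)) (hmV ε) (hmV ε)
  have hmF' : StronglyMeasurable (F' 0) := by
    have hU : ∀ t, c t + (0 : ℝ) • φ t ∈ U := fun t => hS.subset (hmem 0 h0s t)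
    refine StronglyMeasurable.add ?_
      ((h.stronglyMeasurable_apply (hcont 0) hU (hmV 0) hmφ).const_mul 2)
    have hD : Continuous fun t => fderiv ℝ G (c t + (0 : ℝ) • φ t) (φ t) :=
      (h.continuousOn_fderiv.comp_continuous (hcont 0) hU).clm_apply hφ.continuous
    exact continuous_bilinear_apply.comp_stronglyMeasurable
      (hD.stronglyMeasurable.prodMk ((hmV 0).prodMk (hmV 0)))
  have hder := (intervalIntegral.hasDerivAt_integral_of_dominated_loc_of_deriv_le (μ := volume)
    (a := a) (b := b) (F := F) (F' := F') (x₀ := 0) (s := s)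
    (bound := fun _ => C * R * k * k + 2 * (C * k * Kφ)) hs
    (by filter_upwards [hs] with ε hε using (hmF ε hε).aestronglyMeasurable)
    (h.intervalIntegrable_apply hS (hcont 0) (hmem 0 h0s) (hmV 0) (hmV 0) (hbV 0 h0s) (hbV 0 h0s)
      _ _) hmF'.aestronglyMeasurable
    (Eventually.of_forall fun t _ ε hε => by
      refine (norm_add_le _ _).trans (add_le_add ?_ ?_)
      · exact abs_apply_apply_le (ContinuousLinearMap.le_of_opNorm_le_of_le _
          (hS.norm_fderiv_le _ (hmem ε hε t)) (hR t)) (hbV ε hε t) (hbV ε hε t)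
      · rw [norm_mul, Real.norm_ofNat]
        exact mul_le_mul_of_nonneg_left (abs_apply_apply_le (hS.norm_le _ (hmem ε hε t))
          (hbV ε hε t) (hbφ t)) zero_le_two) (by simp)
    (Eventually.of_forall fun t _ ε hε =>
      h.hasDerivAt_energy_density (hS.subset (hmem ε hε t)))).2
  -- The shortest path has energy at most `L ^ 2 * (b - a)`. Every perturbation has the same end
  -- points, so its energy is at least that.
  have hmin : IsLocalMin (fun ε => ∫ t in a..b, F ε t) 0 := by
    filter_upwards [hs] with ε hε
    calc ∫ t in a..b, F 0 t = ∫ t in a..b, G (c t) (deriv c t) (deriv c t) := by simp [F, V]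
      _ ≤ L ^ 2 * (b - a) := h.energy_le hS hc hcρ hab hL hd
      _ ≤ ∫ t in a..b, G (c t + ε • φ t) (deriv (fun t => c t + ε • φ t) t)
            (deriv (fun t => c t + ε • φ t) t) := by
          refine h.le_energy hS (hlip ε) (hmem ε hε) hab hL ?_
          rw [hφ0 a (by simp), hφ0 b (by simp), smul_zero, add_zero, add_zero,
            hd a (left_mem_Icc.2 hab) b (right_mem_Icc.2 hab), abs_of_nonneg (by linarith)]
      _ = ∫ t in a..b, F ε t := by
          refine intervalIntegral.integral_congr_ae ?_
          filter_upwards [hc.ae_differentiableAt_real, hφ.ae_differentiableAt_real]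
            with t h1 h2 _
          have : deriv (fun t => c t + ε • φ t) t = V ε t := by
            exact (h1.hasDerivAt.add (h2.hasDerivAt.const_smul ε)).deriv
          rw [this]
  have := hmin.hasDerivAt_eq_zero hder
  simpa [F', V] using this

/-- The momentum `G (c, c')` of a shortest path is the integral of the force. -/
theorem exists_momentum [FiniteDimensional ℝ E] (h : IsMetricChart U G ψ) (hρ : 0 < ρ)
    (hS : IsMetricBox U G ψ (Metric.closedBall x ρ) C) (hc : LipschitzWith Kc c)
    (hcS : ∀ t, c t ∈ Metric.closedBall x (ρ / 2)) (hab : a < b) (hL : 0 ≤ L)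
    (hd : ∀ s ∈ Icc a b, ∀ t ∈ Icc a b, dist (ψ (c s)) (ψ (c t)) = L * |t - s|) :
    ∃ p : E →L[ℝ] ℝ, ∀ᵐ t ∂volume.restrict (Ioc a b), G (c t) (deriv c t) =
      p + ∫ s in a..t, (1 / 2 : ℝ) • trilinearForce (fderiv ℝ G (c s)) (deriv c s) := by
  have hcU : ∀ t, c t ∈ U := fun t =>
    hS.subset (Metric.closedBall_subset_closedBall (by linarith) (hcS t))
  have hcρ : ∀ t, c t ∈ Metric.closedBall x ρ := fun t =>
    Metric.closedBall_subset_closedBall (by linarith) (hcS t)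
  have hmc := stronglyMeasurable_deriv c
  have hbc : ∀ t, ‖deriv c t‖ ≤ Kc := fun t => norm_deriv_le_of_lipschitz hc
  have hDc : Continuous fun t => fderiv ℝ G (c t) :=
    h.continuousOn_fderiv.comp_continuous hc.continuous hcU
  set H : ℝ → E →L[ℝ] ℝ := fun s =>
    (1 / 2 : ℝ) • trilinearForce (fderiv ℝ G (c s)) (deriv c s)
  have hmH : StronglyMeasurable H := (continuous_trilinearForce.comp_stronglyMeasurable
    (hDc.stronglyMeasurable.prodMk hmc)).const_smul (1 / 2 : ℝ)
  have hbH : ∀ t, ‖H t‖ ≤ 1 / 2 * (C * Kc * Kc) := fun t => by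
    rw [norm_smul, Real.norm_of_nonneg (by norm_num)]
    gcongr
    refine (norm_trilinearForce_le _ _).trans ?_
    gcongr
    exacts [hS.norm_fderiv_le _ (hcρ t), hbc t, hbc t]
  have hintH := fun x y => intervalIntegrable_of_bounded hmH hbH x y
  -- Variations of the form `f • w` with `w` fixed reduce the claim to the scalar lemma of du
  -- Bois-Reymond.
  have key : ∀ w : E, ∃ k : ℝ, ∀ᵐ t ∂volume.restrict (Ioc a b),
      (G (c t) (deriv c t) - ∫ s in a..t, H s) w = k := by
    intro w
    have hmA := h.stronglyMeasurable_apply hc.continuous hcU hmc (stronglyMeasurable_const (b := w))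
    have hmB : StronglyMeasurable fun t => H t w :=
      (ContinuousLinearMap.apply ℝ ℝ w).continuous.comp_stronglyMeasurable hmH
    obtain ⟨k, hk⟩ := ae_eq_const_add_integral_of_forall_integral_eq_zero hab hmA hmB
      (fun t => abs_apply_apply_le (hS.norm_le _ (hcρ t)) (hbc t) le_rfl)
      (fun t => ContinuousLinearMap.le_of_opNorm_le_of_le _ (hbH t) le_rfl) (by
        intro f K hf hf0
        have hφ : LipschitzWith (‖w‖₊ * K) fun t => f t • w := by
          refine LipschitzWith.of_dist_le_mul fun s t => ?_
          rw [dist_eq_norm, ← sub_smul, norm_smul, mul_comm, NNReal.coe_mul, mul_assoc, coe_nnnorm,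
            ← dist_eq_norm]
          gcongr
          exact hf.dist_le_mul s t
        have h1 := h.integral_first_variation_eq_zero hρ hS hc hcS hab.le hL hd hφ
          (fun t ht => by rw [hf0 t ht, zero_smul])
        have h2 : ∫ t in a..b, (fderiv ℝ G (c t) (f t • w) (deriv c t) (deriv c t) +
            2 * G (c t) (deriv c t) (deriv (fun t => f t • w) t)) =
            ∫ t in a..b, 2 * (G (c t) (deriv c t) w * deriv f t + H t w * f t) := by
          refine intervalIntegral.integral_congr_ae ?_
          filter_upwards [hf.ae_differentiableAt_real] with t ht _
          rw [deriv_smul_const ht]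
          simp only [H, map_smul, smul_apply, smul_eq_mul, trilinearForce_apply]
          ring
        rw [h2, intervalIntegral.integral_const_mul] at h1
        simpa using h1)
    refine ⟨k, ?_⟩
    filter_upwards [hk] with t ht
    rw [sub_apply, ht, ContinuousLinearMap.intervalIntegral_apply (hintH a t)]
    ring
  -- A finite basis gives one null set for all `w`. The constant covector is then read off at a
  -- single good time `t₀`.
  let B := Module.finBasis ℝ E
  choose k hk using fun i => key (B i)
  have hall := ae_all_iff.2 hk
  have : (ae (volume.restrict (Ioc a b))).NeBot := by
    rw [ae_neBot, Ne, Measure.restrict_eq_zero]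
    simpa using hab
  obtain ⟨t₀, ht₀⟩ := hall.exists
  refine ⟨G (c t₀) (deriv c t₀) - ∫ s in a..t₀, H s, ?_⟩
  filter_upwards [hall] with t ht
  rw [← sub_eq_iff_eq_add]
  have : ((G (c t) (deriv c t) - ∫ s in a..t, H s : E →L[ℝ] ℝ) : E →ₗ[ℝ] ℝ) =
      (G (c t₀) (deriv c t₀) - ∫ s in a..t₀, H s : E →L[ℝ] ℝ) :=
    B.ext fun i => (ht i).trans (ht₀ i).symm
  exact ContinuousLinearMap.coe_injective this

end IsMetricChart

/-! ### Regularity of shortest paths in a chart -/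

namespace IsMetricChart

variable {E X : Type*} [NormedAddCommGroup E] [NormedSpace ℝ E] [FiniteDimensional ℝ E]
  [PseudoMetricSpace X] {U : Set E} {G : E → E →L[ℝ] E →L[ℝ] ℝ} {ψ : E → X}
  {C Kc : ℝ≥0} {c : ℝ → E} {x : E} {ρ L a b : ℝ}

lemma isInvertible (h : IsMetricChart U G ψ) (hx : x ∈ U) : (G x).IsInvertible :=
  isInvertible_of_pos (h.pos x hx)

lemma contDiffAt_inverse (h : IsMetricChart U G ψ) (hx : x ∈ U) :
    ContDiffAt ℝ ∞ (fun y => (G y).inverse) x := by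
  have : CompleteSpace E := FiniteDimensional.complete ℝ E
  exact (h.isInvertible hx).contDiffAt_map_inverse.comp x (h.contDiffAt hx)

/-- A shortest path parametrized proportionally to arc length is of class `C^2` and satisfies the
geodesic equation. -/
theorem exists_velocity (h : IsMetricChart U G ψ) (hρ : 0 < ρ)
    (hS : IsMetricBox U G ψ (Metric.closedBall x ρ) C) (hc : LipschitzWith Kc c)
    (hcS : ∀ t, c t ∈ Metric.closedBall x (ρ / 2)) (hab : a < b) (hL : 0 ≤ L)
    (hd : ∀ s ∈ Icc a b, ∀ t ∈ Icc a b, dist (ψ (c s)) (ψ (c t)) = L * |t - s|) :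
    ∃ v : ℝ → E, ContDiffOn ℝ 1 v (Icc a b) ∧ ∀ t ∈ Icc a b,
      HasDerivWithinAt c (v t) (Icc a b) t ∧
      ∀ w, G (c t) (derivWithin v (Icc a b) t) w + fderiv ℝ G (c t) (v t) (v t) w
        - 1 / 2 * fderiv ℝ G (c t) w (v t) (v t) = 0 := by
  have : CompleteSpace E := FiniteDimensional.complete ℝ E
  have hcU : ∀ t, c t ∈ U := fun t =>
    hS.subset (Metric.closedBall_subset_closedBall (by linarith) (hcS t))
  have hDc : Continuous fun t => fderiv ℝ G (c t) :=
    h.continuousOn_fderiv.comp_continuous hc.continuous hcU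
  obtain ⟨p, hp⟩ := h.exists_momentum hρ hS hc hcS hab hL hd
  set H : ℝ → E →L[ℝ] ℝ := fun s =>
    (1 / 2 : ℝ) • trilinearForce (fderiv ℝ G (c s)) (deriv c s)
  have hmH : StronglyMeasurable H := (continuous_trilinearForce.comp_stronglyMeasurable
    (hDc.stronglyMeasurable.prodMk (stronglyMeasurable_deriv c))).const_smul (1 / 2 : ℝ)
  have hbH : ∀ t, ‖H t‖ ≤ (1 / 2 * (C * Kc * Kc) : ℝ≥0) := fun t => by
    rw [norm_smul, Real.norm_of_nonneg (by norm_num)]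
    push_cast
    gcongr
    refine (norm_trilinearForce_le _ _).trans ?_
    gcongr
    exacts [hS.norm_fderiv_le _ (Metric.closedBall_subset_closedBall (by linarith) (hcS t)),
      norm_deriv_le_of_lipschitz hc, norm_deriv_le_of_lipschitz hc]
  let P : ℝ → E →L[ℝ] ℝ := fun t => p + ∫ s in a..t, H s
  have hP : Continuous P :=
    continuous_const.add (lipschitzWith_integral_of_bounded hmH hbH a).continuous
  -- A continuous representative of `c'`: the equation momentum `= P` solved for the velocity.
  let v : ℝ → E := fun t => (G (c t)).inverse (P t)
  have hv : Continuous v := by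
    refine Continuous.clm_apply ?_ hP
    exact continuous_iff_continuousAt.2 fun t =>
      (h.contDiffAt_inverse (hcU t)).continuousAt.comp hc.continuous.continuousAt
  have hcv : ∀ᵐ t, t ∈ Ioc a b → deriv c t = v t := by
    rw [← ae_restrict_iff' measurableSet_Ioc]
    filter_upwards [hp] with t ht
    show deriv c t = (G (c t)).inverse (p + ∫ s in a..t, H s)
    rw [← ht, (h.isInvertible (hcU t)).inverse_apply_self]
  have hsub : ∀ t ∈ Icc a b, uIoc a t ⊆ Ioc a b := fun t ht => by
    rw [uIoc_of_le ht.1]; exact Ioc_subset_Ioc_right ht.2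
  -- the curve and its momentum agree on `[a, b]` with functions of class `C^1` on the line
  let c₁ : ℝ → E := fun t => c a + ∫ s in a..t, v s
  have hc₁ : ∀ t, HasDerivAt c₁ (v t) t := fun t =>
    (hv.integral_hasStrictDerivAt a t).hasDerivAt.const_add _
  have hcc₁ : ∀ t ∈ Icc a b, c t = c₁ t := fun t ht => by
    have h1 := hc.integral_deriv_eq_sub a t
    rw [intervalIntegral.integral_congr_ae (g := v)
      (by filter_upwards [hcv] with s hs hst using hs (hsub t ht hst))] at h1
    show c t = c a + ∫ s in a..t, v s
    rw [h1, add_sub_cancel]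
  -- The force with `v` in place of `deriv c` is continuous, so the momentum, and with it the
  -- velocity, gains a derivative.
  let Q : ℝ → E →L[ℝ] ℝ := fun t => (1 / 2 : ℝ) • trilinearForce (fderiv ℝ G (c t)) (v t)
  have hQ : Continuous Q := (continuous_trilinearForce.comp (hDc.prodMk hv)).const_smul (1 / 2 : ℝ)
  let P₁ : ℝ → E →L[ℝ] ℝ := fun t => p + ∫ s in a..t, Q s
  have hP₁ : ∀ t, HasDerivAt P₁ (Q t) t := fun t =>
    (hQ.integral_hasStrictDerivAt a t).hasDerivAt.const_add _
  have hPP₁ : ∀ t ∈ Icc a b, P t = P₁ t := fun t ht => by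
    show p + _ = p + _
    rw [intervalIntegral.integral_congr_ae]
    filter_upwards [hcv] with s hs hst
    simp only [H, Q, hs (hsub t ht hst)]
  have hc₁1 : ContDiff ℝ 1 c₁ := by
    rw [contDiff_one_iff_deriv, show deriv c₁ = v from funext fun t => (hc₁ t).deriv]
    exact ⟨fun t => (hc₁ t).differentiableAt, hv⟩
  have hP₁1 : ContDiff ℝ 1 P₁ := by
    rw [contDiff_one_iff_deriv, show deriv P₁ = Q from funext fun t => (hP₁ t).deriv]
    exact ⟨fun t => (hP₁ t).differentiableAt, hQ⟩
  let v₁ : ℝ → E := fun t => (G (c₁ t)).inverse (P₁ t)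
  have hvv₁ : ∀ t ∈ Icc a b, v t = v₁ t := fun t ht => by
    show (G (c t)).inverse (P t) = (G (c₁ t)).inverse (P₁ t)
    rw [hcc₁ t ht, hPP₁ t ht]
  have hc₁U : ∀ t ∈ Icc a b, c₁ t ∈ U := fun t ht => hcc₁ t ht ▸ hcU t
  have hv₁ : ∀ t ∈ Icc a b, ContDiffAt ℝ 1 v₁ t := fun t ht =>
    (((h.contDiffAt_inverse (hc₁U t ht)).of_le (by norm_cast)).comp t hc₁1.contDiffAt).clm_apply
      hP₁1.contDiffAt
  refine ⟨v, fun t ht => (hv₁ t ht).contDiffWithinAt.congr (fun s hs => hvv₁ s hs) (hvv₁ t ht),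
    fun t ht => ⟨?_, fun w => ?_⟩⟩
  · exact (hc₁ t).hasDerivWithinAt.congr (fun s hs => hcc₁ s hs) (hcc₁ t ht)
  · have hdv : HasDerivAt v₁ (deriv v₁ t) t :=
      ((hv₁ t ht).differentiableAt one_ne_zero).hasDerivAt
    have hdw : derivWithin v (Icc a b) t = deriv v₁ t :=
      (hdv.hasDerivWithinAt.congr (fun s hs => hvv₁ s hs) (hvv₁ t ht)).derivWithin
        (uniqueDiffOn_Icc hab t ht)
    -- Differentiating `G (c₁) v₁ = P₁` by the product rule yields the geodesic equation.
    have heq : (fun s => G (c₁ s) (v₁ s)) =ᶠ[𝓝 t] P₁ := by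
      filter_upwards [(hc₁ t).continuousAt.preimage_mem_nhds (h.isOpen.mem_nhds (hc₁U t ht))]
        with s hs
      exact (h.isInvertible hs).self_apply_inverse _
    have h1 := ((h.differentiableAt (hc₁U t ht)).hasFDerivAt.comp_hasDerivAt t (hc₁ t)).clm_apply
      hdv
    have h2 := congr($(h1.unique ((hP₁ t).congr_of_eventuallyEq heq)) w)
    simp only [add_apply, Function.comp_apply, Q, smul_apply, smul_eq_mul,
      trilinearForce_apply, ← hcc₁ t ht, ← hvv₁ t ht] at h2
    rw [hdw]
    linarith

end IsMetricChart

/-! ### The Riemannian metric of the manifold in a chart -/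

namespace RadialConvexity

noncomputable section Metric

variable {E : Type*} [NormedAddCommGroup E] [NormedSpace ℝ E]
  {M : Type*} [TopologicalSpace M] [ChartedSpace E M] [IsManifold 𝓘(ℝ, E) ∞ M]
  [RiemannianBundle (fun x : M => TangentSpace 𝓘(ℝ, E) x)]

/-- The derivative of the inverse of a chart, as a map from the model space. -/
def chartDeriv (x₀ : M) (y : E) :
    E →L[ℝ] TangentSpace 𝓘(ℝ, E) ((extChartAt 𝓘(ℝ, E) x₀).symm y) :=
  mfderiv 𝓘(ℝ, E) 𝓘(ℝ, E) (extChartAt 𝓘(ℝ, E) x₀).symm y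

omit [IsManifold 𝓘(ℝ, E) ∞ M] [RiemannianBundle (fun x : M => TangentSpace 𝓘(ℝ, E) x)] in
lemma mfderiv_extChartAt_symm_eq (x₀ : M) (y : E) :
    mfderivWithin 𝓘(ℝ, E) 𝓘(ℝ, E) (extChartAt 𝓘(ℝ, E) x₀).symm (range 𝓘(ℝ, E)) y =
      mfderiv 𝓘(ℝ, E) 𝓘(ℝ, E) (extChartAt 𝓘(ℝ, E) x₀).symm y := by
  rw [modelWithCornersSelf_coe, range_id, mfderivWithin_univ]

omit [RiemannianBundle (fun x : M => TangentSpace 𝓘(ℝ, E) x)] in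
-- Coordinate fields are smooth: they are the tangent map of the inverse chart applied to a constant
-- field.
lemma contMDiffOn_mfderiv_extChartAt_symm (x₀ : M) (u : E) :
    ContMDiffOn 𝓘(ℝ, E) 𝓘(ℝ, E).tangent ∞
      (fun y => (⟨(extChartAt 𝓘(ℝ, E) x₀).symm y,
        mfderiv 𝓘(ℝ, E) 𝓘(ℝ, E) (extChartAt 𝓘(ℝ, E) x₀).symm y u⟩ : TangentBundle 𝓘(ℝ, E) M))
      (extChartAt 𝓘(ℝ, E) x₀).target := by
  have ho : IsOpen (extChartAt 𝓘(ℝ, E) x₀).target := isOpen_extChartAt_target x₀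
  have h1 := (contMDiffOn_extChartAt_symm (I := 𝓘(ℝ, E)) (n := ∞) x₀
    ).contMDiffOn_tangentMapWithin (m := ∞) (by simp) ho.uniqueMDiffOn
  have h2 : ContMDiffOn 𝓘(ℝ, E) 𝓘(ℝ, E).tangent ∞
      (fun y => (⟨y, u⟩ : TangentBundle 𝓘(ℝ, E) E)) (extChartAt 𝓘(ℝ, E) x₀).target :=
    contMDiffOn_vectorSpace_iff_contDiffOn.2 contDiffOn_const
  refine (h1.comp h2 fun y hy => hy).congr fun y hy => ?_
  show _ = tangentMapWithin _ _ _ _ _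
  rw [tangentMapWithin, mfderivWithin_of_isOpen ho hy]

lemma chartMetric_contDiffOn [IsContMDiffRiemannianBundle 𝓘(ℝ, E) ∞ E
    (fun x : M => TangentSpace 𝓘(ℝ, E) x)] (x₀ : M) (u v : E) :
    ContDiffOn ℝ ∞ (fun y => chartMetric x₀ y u v) (extChartAt 𝓘(ℝ, E) x₀).target := by
  rw [← contMDiffOn_iff_contDiffOn]
  exact ContMDiffOn.inner_bundle (F := E) (E := fun x : M => TangentSpace 𝓘(ℝ, E) x)
    (b := (extChartAt 𝓘(ℝ, E) x₀).symm) (v := fun y => chartDeriv x₀ y u)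
    (w := fun y => chartDeriv x₀ y v)
    (contMDiffOn_mfderiv_extChartAt_symm x₀ u) (contMDiffOn_mfderiv_extChartAt_symm x₀ v)

omit [IsManifold 𝓘(ℝ, E) ∞ M] in
lemma chartMetric_self (x₀ : M) (y u : E) : chartMetric x₀ y u u =
    ‖chartDeriv x₀ y u‖ ^ 2 :=
  real_inner_self_eq_norm_sq _

lemma chartMetric_pos {x₀ : M} {y : E} (hy : y ∈ (extChartAt 𝓘(ℝ, E) x₀).target) {u : E}
    (hu : u ≠ 0) : 0 < chartMetric x₀ y u u := by
  rw [chartMetric_self]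
  have hinj := (isInvertible_mfderivWithin_extChartAt_symm hy).injective
  rw [mfderiv_extChartAt_symm_eq] at hinj
  have : chartDeriv x₀ y u ≠ 0 := fun h0 =>
    hu (hinj (h0.trans (map_zero (chartDeriv x₀ y)).symm))
  positivity

variable [FiniteDimensional ℝ E]

/-- The Riemannian metric in a chart, as a continuous bilinear form. -/
def chartForm (x₀ : M) (y : E) : E →L[ℝ] E →L[ℝ] ℝ :=
  LinearMap.toContinuousBilinearMap (LinearMap.mk₂ ℝ (chartMetric x₀ y)
    (fun u u' v => (congrArg (fun z => inner ℝ z (chartDeriv x₀ y v))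
      (map_add (chartDeriv x₀ y) u u')).trans (inner_add_left _ _ _))
    (fun r u v => (congrArg (fun z => inner ℝ z (chartDeriv x₀ y v))
      (map_smul (chartDeriv x₀ y) r u)).trans (real_inner_smul_left _ _ _))
    (fun u v v' => (congrArg (fun z => inner ℝ (chartDeriv x₀ y u) z)
      (map_add (chartDeriv x₀ y) v v')).trans (inner_add_right _ _ _))
    (fun r u v => (congrArg (fun z => inner ℝ (chartDeriv x₀ y u) z)
      (map_smul (chartDeriv x₀ y) r v)).trans (real_inner_smul_right _ _ _)))

omit [IsManifold 𝓘(ℝ, E) ∞ M] in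
@[simp] lemma chartForm_apply (x₀ : M) (y u v : E) :
    chartForm x₀ y u v = chartMetric x₀ y u v := rfl

variable [IsContMDiffRiemannianBundle 𝓘(ℝ, E) ∞ E (fun x : M => TangentSpace 𝓘(ℝ, E) x)]

lemma chartForm_contDiffOn (x₀ : M) :
    ContDiffOn ℝ ∞ (chartForm x₀) (extChartAt 𝓘(ℝ, E) x₀).target := by
  rw [contDiffOn_clm_apply]
  intro u
  rw [contDiffOn_clm_apply]
  exact chartMetric_contDiffOn x₀ u

lemma fderiv_chartMetric {x₀ : M} {y : E} (hy : y ∈ (extChartAt 𝓘(ℝ, E) x₀).target) (u v w : E) :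
    fderiv ℝ (fun z => chartMetric x₀ z u v) y w = fderiv ℝ (chartForm x₀) y w u v := by
  have h1 : HasFDerivAt (chartForm x₀) (fderiv ℝ (chartForm x₀) y) y :=
    (((chartForm_contDiffOn x₀).contDiffAt
      ((isOpen_extChartAt_target x₀).mem_nhds hy)).differentiableAt (by simp)).hasFDerivAt
  have h2 := ((((ContinuousLinearMap.apply ℝ ℝ v).comp
    (ContinuousLinearMap.apply ℝ (E →L[ℝ] ℝ) u)).hasFDerivAt).comp y h1)
  exact congr($(h2.fderiv) w)

/-- On the diagonal the first two terms coincide by definition, which leaves the Euler-Lagrange form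
found in `IsMetricChart.exists_velocity`. -/
lemma christoffel_self {x₀ : M} {y : E} (hy : y ∈ (extChartAt 𝓘(ℝ, E) x₀).target) (v w : E) :
    christoffel x₀ y v v w = fderiv ℝ (chartForm x₀) y v v w
      - 1 / 2 * fderiv ℝ (chartForm x₀) y w v v := by
  simp only [christoffel, fderiv_chartMetric hy]
  ring

end Metric

end RadialConvexity

/-! ### Comparison of the Riemannian distance with the metric in a chart -/

/-- Nearby quadratic forms are comparable to a positive definite one. -/
lemma eventually_sqrt_le_mul_sqrt {E : Type*} [NormedAddCommGroup E] [NormedSpace ℝ E]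
    [FiniteDimensional ℝ E] {G : E → E →L[ℝ] E →L[ℝ] ℝ} {x : E} (hG : ContinuousAt G x)
    (hpos : ∀ v, v ≠ 0 → 0 < G x v v) {K : ℝ} (hK : 1 < K) :
    ∀ᶠ z in 𝓝 x, ∀ w, √(G x w w) ≤ K * √(G z w w) ∧ √(G z w w) ≤ K * √(G x w w) := by
  obtain ⟨m, hm, hmv⟩ := exists_coercive_of_pos hpos
  have hK0 : 0 < K := by linarith
  have hK2 : 1 < K ^ 2 := one_lt_pow₀ hK two_ne_zero
  have hθ : 0 < 1 - (K ^ 2)⁻¹ := sub_pos.2 (inv_lt_one_of_one_lt₀ hK2)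
  -- By coercivity this radius gives `|G z w w - G x w w| ≤ (1 - K⁻²) * G x w w`. The upper bound
  -- then uses `2 - K⁻² ≤ K ^ 2`.
  filter_upwards [Metric.continuousAt_iff'.1 hG (m * (1 - (K ^ 2)⁻¹)) (by positivity)] with z hz w
  rw [dist_eq_norm] at hz
  have h1 : |G z w w - G x w w| ≤ (1 - (K ^ 2)⁻¹) * G x w w := by
    have h2 : ‖(G z - G x) w w‖ ≤ m * (1 - (K ^ 2)⁻¹) * ‖w‖ * ‖w‖ :=
      abs_apply_apply_le hz.le le_rfl le_rfl
    calc |G z w w - G x w w| ≤ m * (1 - (K ^ 2)⁻¹) * ‖w‖ * ‖w‖ := h2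
      _ = (1 - (K ^ 2)⁻¹) * (m * ‖w‖ ^ 2) := by ring
      _ ≤ _ := by gcongr; exact hmv w
  obtain ⟨h2, h3⟩ := abs_le.1 h1
  have hx0 : 0 ≤ G x w w := le_trans (by positivity) (hmv w)
  have hi : K ^ 2 * (K ^ 2)⁻¹ = 1 := mul_inv_cancel₀ (by positivity)
  have hi0 : 0 < (K ^ 2)⁻¹ := by positivity
  constructor
  · rw [← Real.sqrt_sq hK0.le, ← Real.sqrt_mul (by positivity)]
    refine Real.sqrt_le_sqrt ?_
    have h4 : (K ^ 2)⁻¹ * G x w w ≤ G z w w := by linarith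
    calc G x w w = K ^ 2 * ((K ^ 2)⁻¹ * G x w w) := by rw [← mul_assoc, hi, one_mul]
      _ ≤ K ^ 2 * G z w w := by gcongr
  · rw [← Real.sqrt_sq hK0.le, ← Real.sqrt_mul (by positivity)]
    refine Real.sqrt_le_sqrt ?_
    have h4 : 2 - (K ^ 2)⁻¹ ≤ K ^ 2 := by nlinarith [sq_nonneg (K ^ 2 - 1)]
    calc G z w w ≤ (2 - (K ^ 2)⁻¹) * G x w w := by linarith
      _ ≤ K ^ 2 * G x w w := by gcongr

namespace RadialConvexity

section Length

variable {E : Type*} [NormedAddCommGroup E] [NormedSpace ℝ E] [FiniteDimensional ℝ E]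
  {M : Type*} [TopologicalSpace M] [ChartedSpace E M] [IsManifold 𝓘(ℝ, E) ∞ M]
  [RiemannianBundle (fun x : M => TangentSpace 𝓘(ℝ, E) x)]

omit [IsManifold 𝓘(ℝ, E) ∞ M] in
lemma norm_chartDeriv (x₀ : M) (y u : E) : ‖chartDeriv x₀ y u‖ = √(chartForm x₀ y u u) := by
  rw [chartForm_apply, chartMetric_self, Real.sqrt_sq (norm_nonneg _)]

omit [IsManifold 𝓘(ℝ, E) ∞ M] in
lemma abs_chartForm_le (x₀ : M) (y u v : E) :
    |chartForm x₀ y u v| ≤ √(chartForm x₀ y u u) * √(chartForm x₀ y v v) := by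
  rw [← norm_chartDeriv, ← norm_chartDeriv]
  exact abs_real_inner_le_norm (chartDeriv x₀ y u) (chartDeriv x₀ y v)

omit [FiniteDimensional ℝ E] [RiemannianBundle (fun x : M => TangentSpace 𝓘(ℝ, E) x)] in
lemma mfderivWithin_symm_comp {x₀ : M} {c : ℝ → E} {a b t : ℝ} (hab : a < b) (ht : t ∈ Icc a b)
    (hc : DifferentiableWithinAt ℝ c (Icc a b) t)
    (hmem : c t ∈ (extChartAt 𝓘(ℝ, E) x₀).target) :
    mfderivWithin 𝓘(ℝ, ℝ) 𝓘(ℝ, E) (fun s => (extChartAt 𝓘(ℝ, E) x₀).symm (c s)) (Icc a b) t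
      (1 : ℝ) = chartDeriv x₀ (c t) (derivWithin c (Icc a b) t) := by
  have hsymm : MDifferentiableAt 𝓘(ℝ, E) 𝓘(ℝ, E) (extChartAt 𝓘(ℝ, E) x₀).symm (c t) :=
    ((contMDiffOn_extChartAt_symm (I := 𝓘(ℝ, E)) (n := ∞) x₀).contMDiffAt
      ((isOpen_extChartAt_target x₀).mem_nhds hmem)).mdifferentiableAt (by simp)
  have h1 := mfderiv_comp_mfderivWithin t hsymm
    (mdifferentiableWithinAt_iff_differentiableWithinAt.2 hc)
    (uniqueMDiffWithinAt_iff_uniqueDiffWithinAt.2 (uniqueDiffOn_Icc hab t ht))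
  have h2 := congr($h1 (1 : ℝ))
  refine h2.trans ?_
  show chartDeriv x₀ (c t) (mfderivWithin 𝓘(ℝ, ℝ) 𝓘(ℝ, E) c (Icc a b) t (1 : ℝ)) = _
  rw [mfderivWithin_eq_fderivWithin, ← fderivWithin_derivWithin]
  rfl

lemma pathELength_eq_lintegral_chartForm {x₀ : M} {γ : ℝ → M} {c : ℝ → E} {a b : ℝ} (hab : a < b)
    (hc : ContDiffOn ℝ 1 c (Icc a b)) (hmem : ∀ t ∈ Icc a b, c t ∈ (extChartAt 𝓘(ℝ, E) x₀).target)
    (hγ : ∀ t ∈ Icc a b, γ t = (extChartAt 𝓘(ℝ, E) x₀).symm (c t)) :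
    pathELength 𝓘(ℝ, E) γ a b = ∫⁻ t in Icc a b, ENNReal.ofReal
      √(chartForm x₀ (c t) (derivWithin c (Icc a b) t) (derivWithin c (Icc a b) t)) := by
  rw [pathELength_congr hγ, pathELength_eq_lintegral_mfderivWithin_Icc]
  refine setLIntegral_congr_fun measurableSet_Icc fun t ht => ?_
  rw [← norm_chartDeriv, ofReal_norm]
  exact congrArg _ (mfderivWithin_symm_comp hab ht (hc.differentiableOn one_ne_zero t ht)
    (hmem t ht))

end Length

section Path

variable {E : Type*} [NormedAddCommGroup E] [NormedSpace ℝ E]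
  {M : Type*} [MetricSpace M] [ChartedSpace E M]
  [RiemannianBundle (fun x : M => TangentSpace 𝓘(ℝ, E) x)] [IsRiemannianManifold 𝓘(ℝ, E) M]

lemma exists_path_of_dist_lt {x y : M} {d : ℝ} (hd : dist x y < d) :
    ∃ γ : ℝ → M, γ 0 = x ∧ γ 1 = y ∧ ContMDiffOn 𝓘(ℝ, ℝ) 𝓘(ℝ, E) 1 γ (Icc 0 1) ∧
      pathELength 𝓘(ℝ, E) γ 0 1 < ENNReal.ofReal d := by
  refine exists_lt_of_riemannianEDist_lt ?_
  rw [← IsRiemannianManifold.out (I := 𝓘(ℝ, E)), edist_dist]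
  exact (ENNReal.ofReal_lt_ofReal_iff (dist_nonneg.trans_lt hd)).2 hd

lemma edist_le_pathELength {γ : ℝ → M} {a b s t : ℝ}
    (hγ : ContMDiffOn 𝓘(ℝ, ℝ) 𝓘(ℝ, E) 1 γ (Icc a b)) (hs : a ≤ s) (hst : s ≤ t) (ht : t ≤ b) :
    edist (γ s) (γ t) ≤ pathELength 𝓘(ℝ, E) γ s t := by
  rw [IsRiemannianManifold.out (I := 𝓘(ℝ, E))]
  exact riemannianEDist_le_pathELength (hγ.mono (Icc_subset_Icc hs ht)) rfl rfl hst

/-- On an almost minimal path the intermediate value theorem finds a point at distance exactly `s`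
from `x`; the rest of the path has length less than `dist x y - s + ε`. -/
lemma hasApproxBetween (E M : Type*) [NormedAddCommGroup E] [NormedSpace ℝ E] [MetricSpace M]
    [ChartedSpace E M] [RiemannianBundle (fun x : M => TangentSpace 𝓘(ℝ, E) x)]
    [IsRiemannianManifold 𝓘(ℝ, E) M] : HasApproxBetween M := by
  intro x y s h0 hs ε hε
  obtain ⟨γ, hγ0, hγ1, hγ, hlen⟩ := exists_path_of_dist_lt (E := E) (x := x) (y := y)
    (d := dist x y + ε) (by linarith)
  have hcont : ContinuousOn (fun t => dist x (γ t)) (Icc 0 1) :=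
    (continuous_const.dist continuous_id).comp_continuousOn hγ.continuousOn
  obtain ⟨t, ht, hts⟩ := intermediate_value_Icc zero_le_one hcont
    (show s ∈ Icc (dist x (γ 0)) (dist x (γ 1)) by simpa [hγ0, hγ1] using ⟨h0, hs⟩)
  refine ⟨γ t, hts.le, ?_⟩
  have h1 := edist_le_pathELength hγ le_rfl ht.1 ht.2
  have h2 := edist_le_pathELength hγ ht.1 ht.2 le_rfl
  rw [hγ0, edist_dist, show dist x (γ t) = s from hts] at h1
  rw [hγ1, edist_dist] at h2
  have h3 := (add_le_add h1 h2).trans_lt ((pathELength_add ht.1 ht.2).trans_lt hlen)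
  rw [← ENNReal.ofReal_add h0 dist_nonneg, ENNReal.ofReal_lt_ofReal_iff (by positivity)] at h3
  linarith

end Path

section Comparison

variable {E : Type*} [NormedAddCommGroup E] [NormedSpace ℝ E] [FiniteDimensional ℝ E]
  {M : Type*} [MetricSpace M] [ChartedSpace E M] [IsManifold 𝓘(ℝ, E) ∞ M]
  [RiemannianBundle (fun x : M => TangentSpace 𝓘(ℝ, E) x)]
  [IsContMDiffRiemannianBundle 𝓘(ℝ, E) ∞ E (fun x : M => TangentSpace 𝓘(ℝ, E) x)]

lemma eventually_chartForm_comparable {x₀ : M} {x : E} (hx : x ∈ (extChartAt 𝓘(ℝ, E) x₀).target)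
    {K : ℝ} (hK : 1 < K) : ∃ r > 0, ∀ z ∈ Metric.ball x r, z ∈ (extChartAt 𝓘(ℝ, E) x₀).target ∧
      ∀ w, √(chartForm x₀ x w w) ≤ K * √(chartForm x₀ z w w) ∧
        √(chartForm x₀ z w w) ≤ K * √(chartForm x₀ x w w) := by
  have ho := (isOpen_extChartAt_target (I := 𝓘(ℝ, E)) x₀)
  exact Metric.eventually_nhds_iff_ball.1 ((ho.eventually_mem hx).and (eventually_sqrt_le_mul_sqrt
    ((chartForm_contDiffOn x₀).continuousOn.continuousAt (ho.mem_nhds hx))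
    (fun v hv => chartMetric_pos hx hv) hK))

variable [IsRiemannianManifold 𝓘(ℝ, E) M]

/-- The distance is at most the length of the coordinate segment, along which the metric is
comparable to its value at `x`. -/
lemma eventually_dist_le_mul_sqrt {x₀ : M} {x : E} (hx : x ∈ (extChartAt 𝓘(ℝ, E) x₀).target)
    {K : ℝ} (hK : 1 < K) : ∀ᶠ p in 𝓝 (x, x), dist ((extChartAt 𝓘(ℝ, E) x₀).symm p.1)
      ((extChartAt 𝓘(ℝ, E) x₀).symm p.2) ≤ K * √(chartForm x₀ x (p.2 - p.1) (p.2 - p.1)) := by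
  obtain ⟨r, hr, hball⟩ := eventually_chartForm_comparable hx hK
  filter_upwards [Metric.ball_mem_nhds (x, x) hr] with p hp
  rw [← ball_prod_same] at hp
  obtain ⟨y, z⟩ := p
  obtain ⟨hy, hz⟩ : y ∈ Metric.ball x r ∧ z ∈ Metric.ball x r := hp
  let c : ℝ → E := AffineMap.lineMap y z
  have hc : ContDiff ℝ 1 c := (ContinuousAffineMap.lineMap (R := ℝ) y z).contDiff
  have hcd : ∀ t, HasDerivAt c (z - y) t := fun t => AffineMap.hasDerivAt_lineMap
  have hcb : ∀ t ∈ Icc (0 : ℝ) 1, c t ∈ Metric.ball x r := fun t ht =>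
    (convex_ball x r).lineMap_mem hy hz ht
  have hsm : ContMDiffOn 𝓘(ℝ, ℝ) 𝓘(ℝ, E) 1 (fun t => (extChartAt 𝓘(ℝ, E) x₀).symm (c t))
      (Icc 0 1) :=
    (contMDiffOn_extChartAt_symm x₀).comp hc.contMDiff.contMDiffOn fun t ht => (hball _ (hcb t ht)).1
  have h1 : riemannianEDist 𝓘(ℝ, E) _ _ ≤ _ :=
    riemannianEDist_le_pathELength hsm rfl rfl zero_le_one
  rw [pathELength_eq_lintegral_chartForm zero_lt_one hc.contDiffOn
    (fun t ht => (hball _ (hcb t ht)).1) (fun t _ => rfl), ← IsRiemannianManifold.out] at h1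
  have h2 : ∫⁻ t in Icc (0 : ℝ) 1, ENNReal.ofReal √(chartForm x₀ (c t)
      (derivWithin c (Icc 0 1) t) (derivWithin c (Icc 0 1) t)) ≤
      ∫⁻ t in Icc (0 : ℝ) 1, ENNReal.ofReal (K * √(chartForm x₀ x (z - y) (z - y))) := by
    refine setLIntegral_mono' measurableSet_Icc fun t ht => ENNReal.ofReal_le_ofReal ?_
    rw [(hcd t).hasDerivWithinAt.derivWithin (uniqueDiffOn_Icc zero_lt_one t ht)]
    exact ((hball _ (hcb t ht)).2 _).2
  have h3 := h1.trans h2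
  rw [edist_dist] at h3
  simp only [lintegral_const, MeasurableSet.univ, Measure.restrict_apply, univ_inter,
    Real.volume_Icc, sub_zero, ENNReal.ofReal_one, mul_one] at h3
  simpa [c] using (ENNReal.ofReal_le_ofReal_iff (by positivity)).1 h3

/-- Almost minimal paths between nearby points stay where the metric is comparable to its value at
`x`, and for that constant metric no path is shorter than the segment. -/
lemma eventually_sqrt_le_mul_dist {x₀ : M} {x : E} (hx : x ∈ (extChartAt 𝓘(ℝ, E) x₀).target)
    {K : ℝ} (hK : 1 < K) : ∀ᶠ p in 𝓝 (x, x), √(chartForm x₀ x (p.2 - p.1) (p.2 - p.1)) ≤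
      K * dist ((extChartAt 𝓘(ℝ, E) x₀).symm p.1) ((extChartAt 𝓘(ℝ, E) x₀).symm p.2) := by
  obtain ⟨r, hr, hball⟩ := eventually_chartForm_comparable hx hK
  set e := extChartAt 𝓘(ℝ, E) x₀
  have hxs : e.symm x ∈ e.source := e.map_target hx
  have hV : e.source ∩ e ⁻¹' Metric.ball x r ∈ 𝓝 (e.symm x) := by
    refine inter_mem (extChartAt_source_mem_nhds' hxs) ?_
    refine (continuousAt_extChartAt' hxs).preimage_mem_nhds ?_
    rw [e.right_inv hx]
    exact Metric.ball_mem_nhds _ hr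
  obtain ⟨R, hR, hRV⟩ := Metric.mem_nhds_iff.1 hV
  -- End points within `R / 3` of the centre: a path of length less than `2 * R / 3` between them
  -- stays in the ball of radius `R`.
  have hnear : ∀ᶠ y in 𝓝 x, y ∈ e.target ∧ e.symm y ∈ Metric.ball (e.symm x) (R / 3) :=
    ((isOpen_extChartAt_target x₀).eventually_mem hx).and
      ((continuousAt_extChartAt_symm'' hx).preimage_mem_nhds
        (Metric.ball_mem_nhds _ (by positivity)))
  have hnear2 : ∀ᶠ p in 𝓝 (x, x), (p.1 ∈ e.target ∧ e.symm p.1 ∈ Metric.ball (e.symm x) (R / 3)) ∧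
      (p.2 ∈ e.target ∧ e.symm p.2 ∈ Metric.ball (e.symm x) (R / 3)) :=
    ((continuous_fst.tendsto (x, x)).eventually hnear).and
      ((continuous_snd.tendsto (x, x)).eventually hnear)
  filter_upwards [hnear2] with p hp
  obtain ⟨y, z⟩ := p
  obtain ⟨⟨hy, hyR⟩, hz, hzR⟩ := hp
  simp only [Metric.mem_ball] at *
  set u := z - y
  set s := √(chartForm x₀ x u u)
  have hdyz : dist (e.symm y) (e.symm z) < 2 * R / 3 := by
    have := dist_triangle_right (e.symm y) (e.symm z) (e.symm x)
    linarith
  -- it suffices to bound from below the length of a short path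
  suffices h : ∀ d, dist (e.symm y) (e.symm z) < d → d < 2 * R / 3 → s ≤ K * d by
    have hlim : Tendsto (fun d => K * d) (𝓝[>] dist (e.symm y) (e.symm z))
        (𝓝 (K * dist (e.symm y) (e.symm z))) :=
      ((by fun_prop : Continuous fun d => K * d).tendsto _).mono_left nhdsWithin_le_nhds
    refine ge_of_tendsto hlim ?_
    filter_upwards [Ioo_mem_nhdsGT hdyz] with d hd using h d hd.1 hd.2
  intro d hd hdR
  have hd0 : 0 < d := dist_nonneg.trans_lt hd
  obtain ⟨γ, hγ0, hγ1, hγ, hlen⟩ := exists_path_of_dist_lt (E := E) hd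
  have hγV : ∀ t ∈ Icc (0 : ℝ) 1, γ t ∈ e.source ∩ e ⁻¹' Metric.ball x r := by
    intro t ht
    refine hRV ?_
    have h1 := (edist_le_pathELength hγ le_rfl ht.1 ht.2).trans_lt
      ((pathELength_mono le_rfl ht.2).trans_lt hlen)
    rw [edist_dist, ENNReal.ofReal_lt_ofReal_iff hd0, hγ0, dist_comm] at h1
    rw [Metric.mem_ball]
    linarith [dist_triangle (γ t) (e.symm y) (e.symm x)]
  let c : ℝ → E := fun t => e (γ t)
  have hc : ContDiffOn ℝ 1 c (Icc 0 1) := by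
    rw [← contMDiffOn_iff_contDiffOn]
    refine contMDiffOn_extChartAt.comp hγ fun t ht => ?_
    have := (hγV t ht).1
    rwa [extChartAt_source] at this
  have hcb : ∀ t ∈ Icc (0 : ℝ) 1, c t ∈ Metric.ball x r := fun t ht => (hγV t ht).2
  have hc0 : c 0 = y := by simp only [c, hγ0, e.right_inv hy]
  have hc1 : c 1 = z := by simp only [c, hγ1, e.right_inv hz]
  rw [pathELength_eq_lintegral_chartForm zero_lt_one hc (fun t ht => (hball _ (hcb t ht)).1)
    (fun t ht => (e.left_inv (hγV t ht).1).symm)] at hlen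
  -- The linear functional `G x (u, ·)` calibrates the path: it grows by `s ^ 2` from `y` to `z`,
  -- while Cauchy-Schwarz bounds its growth by `s * K` times the length.
  have hf : ContDiffOn ℝ 1 (fun t => chartForm x₀ x u (c t)) (Icc 0 1) :=
    (chartForm x₀ x u).contDiff.comp_contDiffOn hc
  have h1 := enorm_sub_le_lintegral_derivWithin_Icc_of_contDiffOn_Icc hf zero_le_one
  have h2 : ∫⁻ t in Icc (0 : ℝ) 1, ‖derivWithin (fun t => chartForm x₀ x u (c t)) (Icc 0 1) t‖ₑ ≤
      ∫⁻ t in Icc (0 : ℝ) 1, ENNReal.ofReal (s * K) * ENNReal.ofReal √(chartForm x₀ (c t)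
        (derivWithin c (Icc 0 1) t) (derivWithin c (Icc 0 1) t)) := by
    refine setLIntegral_mono' measurableSet_Icc fun t ht => ?_
    rw [← ENNReal.ofReal_mul (by positivity), ← ofReal_norm]
    refine ENNReal.ofReal_le_ofReal ?_
    have hder : HasDerivWithinAt (fun t => chartForm x₀ x u (c t))
        (chartForm x₀ x u (derivWithin c (Icc 0 1) t)) (Icc 0 1) t :=
      (chartForm x₀ x u).hasFDerivAt.comp_hasDerivWithinAt t
        (hc.differentiableOn one_ne_zero t ht).hasDerivWithinAt
    rw [hder.derivWithin (uniqueDiffOn_Icc zero_lt_one t ht), mul_assoc]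
    refine (abs_chartForm_le _ _ _ _).trans ?_
    gcongr
    exact ((hball _ (hcb t ht)).2 _).1
  rw [lintegral_const_mul' _ _ ENNReal.ofReal_ne_top] at h2
  have h3 := (h1.trans h2).trans (mul_le_mul_right hlen.le _)
  rw [hc0, hc1, ← map_sub, ← ofReal_norm, ← ENNReal.ofReal_mul (by positivity),
    ENNReal.ofReal_le_ofReal_iff (by positivity)] at h3
  have hs0 : 0 ≤ chartForm x₀ x u u := by
    rw [chartForm_apply, chartMetric_self]; positivity
  have h4 : s * s ≤ s * (K * d) := by
    calc s * s = chartForm x₀ x u u := Real.mul_self_sqrt hs0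
      _ ≤ ‖chartForm x₀ x u u‖ := le_abs_self _
      _ ≤ s * K * d := h3
      _ = s * (K * d) := by ring
  rcases (Real.sqrt_nonneg _ : 0 ≤ s).eq_or_lt with h | h
  · exact h.symm.le.trans (by positivity)
  · exact le_of_mul_le_mul_left h4 h

theorem isMetricChart (x₀ : M) : IsMetricChart (extChartAt 𝓘(ℝ, E) x₀).target (chartForm x₀)
    (extChartAt 𝓘(ℝ, E) x₀).symm where
  isOpen := isOpen_extChartAt_target x₀
  contDiffOn := chartForm_contDiffOn x₀
  symm y _ u v := real_inner_comm (chartDeriv x₀ y v) (chartDeriv x₀ y u)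
  pos _ hx _ hv := chartMetric_pos hx hv
  sqrt_le_dist _ hx _ hK := eventually_sqrt_le_mul_dist hx hK
  dist_le_sqrt _ hx _ hK := eventually_dist_le_mul_sqrt hx hK

end Comparison

end RadialConvexity

/-! ### Shortest paths in the manifold are geodesics -/

namespace RadialConvexity

variable {E : Type*} [NormedAddCommGroup E] [NormedSpace ℝ E] [FiniteDimensional ℝ E]
  {M : Type*} [MetricSpace M] [ChartedSpace E M] [IsManifold 𝓘(ℝ, E) ∞ M]
  [RiemannianBundle (fun x : M => TangentSpace 𝓘(ℝ, E) x)]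
  [IsContMDiffRiemannianBundle 𝓘(ℝ, E) ∞ E (fun x : M => TangentSpace 𝓘(ℝ, E) x)]
  [IsRiemannianManifold 𝓘(ℝ, E) M]

/-- In a chart, a shortest path parametrized proportionally to arc length is locally of class `C^2`
and satisfies the geodesic equation. -/
lemma exists_chart_velocity {γ : ℝ → M} {L : ℝ} (hL : 0 ≤ L)
    (hγ : ∀ s ∈ Icc (0 : ℝ) 1, ∀ t ∈ Icc (0 : ℝ) 1, dist (γ s) (γ t) = L * |t - s|)
    (x₀ : M) {t₀ : ℝ} (ht₀ : t₀ ∈ Icc (0 : ℝ) 1) (hsrc : γ t₀ ∈ (extChartAt 𝓘(ℝ, E) x₀).source) :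
    ∃ (a b : ℝ) (v : ℝ → E), a < b ∧ Icc a b ∈ 𝓝[Icc 0 1] t₀ ∧ Icc a b ⊆ Icc 0 1 ∧
      (∀ t ∈ Icc a b, γ t ∈ (extChartAt 𝓘(ℝ, E) x₀).source) ∧ ContDiffOn ℝ 1 v (Icc a b) ∧
      ∀ t ∈ Icc a b,
        HasDerivWithinAt (fun s => extChartAt 𝓘(ℝ, E) x₀ (γ s)) (v t) (Icc a b) t ∧
        ∀ w, chartForm x₀ (extChartAt 𝓘(ℝ, E) x₀ (γ t)) (derivWithin v (Icc a b) t) w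
          + christoffel x₀ (extChartAt 𝓘(ℝ, E) x₀ (γ t)) (v t) (v t) w = 0 := by
  set e := extChartAt 𝓘(ℝ, E) x₀
  have hx : e (γ t₀) ∈ e.target := e.map_source hsrc
  obtain ⟨ρ, hρ, C, hbox⟩ := (isMetricChart x₀).exists_isMetricBox hx
  have hcont : ContinuousOn γ (Icc 0 1) := by
    refine LipschitzOnWith.continuousOn (K := L.toNNReal) (LipschitzOnWith.of_dist_le_mul ?_)
    intro s hs t ht
    rw [hγ s hs t ht, Real.dist_eq, abs_sub_comm, Real.coe_toNNReal L hL]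
  have hnear : e.source ∩ e ⁻¹' Metric.closedBall (e (γ t₀)) (ρ / 2) ∈ 𝓝 (γ t₀) :=
    inter_mem (extChartAt_source_mem_nhds' hsrc) ((continuousAt_extChartAt' hsrc).preimage_mem_nhds
      (Metric.closedBall_mem_nhds _ (by positivity)))
  obtain ⟨δ, hδ, hsub⟩ := Metric.mem_nhdsWithin_iff.1 (hcont t₀ ht₀ hnear)
  set a := max 0 (t₀ - δ / 2) with ha
  set b := min 1 (t₀ + δ / 2) with hb
  have hab : a < b := by
    simp only [ha, hb, lt_min_iff, max_lt_iff]
    refine ⟨⟨by norm_num, ?_⟩, ?_, ?_⟩ <;> linarith [ht₀.1, ht₀.2]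
  have hab01 : Icc a b ⊆ Icc 0 1 := Icc_subset_Icc (le_max_left _ _) (min_le_left _ _)
  have hgood : ∀ t ∈ Icc a b, γ t ∈ e.source ∧ e (γ t) ∈ Metric.closedBall (e (γ t₀)) (ρ / 2) := by
    intro t ht
    refine hsub ⟨?_, hab01 ht⟩
    have h1 := (le_max_right _ _).trans ht.1
    have h2 := ht.2.trans (min_le_right _ _)
    rw [Metric.mem_ball, Real.dist_eq, abs_lt]
    constructor <;> linarith
  -- `projIcc` extends the curve by constants, since the chart results concern Lipschitz curves on
  -- the whole line.
  let c : ℝ → E := fun t => e (γ (projIcc a b hab.le t))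
  have hcγ : ∀ t, e.symm (c t) = γ (projIcc a b hab.le t) := fun t =>
    e.left_inv (hgood _ (Subtype.prop _)).1
  have hcS : ∀ t, c t ∈ Metric.closedBall (e (γ t₀)) (ρ / 2) := fun t =>
    (hgood _ (Subtype.prop _)).2
  have hcS' : ∀ t, c t ∈ Metric.closedBall (e (γ t₀)) ρ := fun t =>
    Metric.closedBall_subset_closedBall (by linarith) (hcS t)
  have hclip : LipschitzWith (C * L.toNNReal) c := by
    refine LipschitzWith.of_dist_le_mul fun s t => ?_
    refine (hbox.dist_le _ (hcS' s) _ (hcS' t)).trans ?_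
    rw [hcγ, hcγ, hγ _ (hab01 (Subtype.prop _)) _ (hab01 (Subtype.prop _)), NNReal.coe_mul,
      mul_assoc, Real.coe_toNNReal L hL, abs_sub_comm]
    gcongr
    have h := (LipschitzWith.projIcc hab.le).dist_le_mul s t
    rwa [NNReal.coe_one, one_mul] at h
  have hcc : ∀ t ∈ Icc a b, e (γ t) = c t := fun t ht => by
    simp only [c, projIcc_of_mem hab.le ht]
  obtain ⟨v, hv, hvt⟩ := (isMetricChart x₀).exists_velocity hρ hbox hclip hcS hab hL
    (fun s hs t ht => by
      rw [hcγ, hcγ, projIcc_of_mem hab.le hs, projIcc_of_mem hab.le ht]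
      exact hγ s (hab01 hs) t (hab01 ht))
  refine ⟨a, b, v, hab, ?_, hab01, fun t ht => (hgood t ht).1, hv, fun t ht => ⟨?_, fun w => ?_⟩⟩
  · refine mem_nhdsWithin.2 ⟨Ioo (t₀ - δ / 2) (t₀ + δ / 2), isOpen_Ioo,
      ⟨by linarith, by linarith⟩, fun t ht => ?_⟩
    exact ⟨max_le ht.2.1 ht.1.1.le, le_min ht.2.2 ht.1.2.le⟩
  · exact (hvt t ht).1.congr hcc (hcc t ht)
  · rw [christoffel_self (e.map_source (hgood t ht).1), hcc t ht, ← add_sub_assoc]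
    exact (hvt t ht).2 w

-- The vectors lie in different fibres, so their equality can only be expressed in the model space
-- `E`.
omit [FiniteDimensional ℝ E] [IsManifold 𝓘(ℝ, E) ∞ M]
  [IsContMDiffRiemannianBundle 𝓘(ℝ, E) ∞ E (fun x : M => TangentSpace 𝓘(ℝ, E) x)]
  [IsRiemannianManifold 𝓘(ℝ, E) M] in
lemma enorm_tangentSpace_congr {x y : M} (h : x = y) {u : TangentSpace 𝓘(ℝ, E) x}
    {w : TangentSpace 𝓘(ℝ, E) y} (huw : (show E from u) = (show E from w)) : ‖u‖ₑ = ‖w‖ₑ := by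
  subst h
  exact congrArg _ huw

omit [FiniteDimensional ℝ E]
  [IsContMDiffRiemannianBundle 𝓘(ℝ, E) ∞ E (fun x : M => TangentSpace 𝓘(ℝ, E) x)]
  [IsRiemannianManifold 𝓘(ℝ, E) M] in
lemma enorm_mfderivWithin_eq {γ : ℝ → M} {x₀ : M} {t : ℝ} (ht : t ∈ Icc (0 : ℝ) 1)
    (hsrc : ∀ᶠ s in 𝓝[Icc 0 1] t, γ s ∈ (extChartAt 𝓘(ℝ, E) x₀).source)
    (hc : DifferentiableWithinAt ℝ (fun s => extChartAt 𝓘(ℝ, E) x₀ (γ s)) (Icc 0 1) t) :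
    ‖mfderivWithin 𝓘(ℝ, ℝ) 𝓘(ℝ, E) γ (Icc 0 1) t (1 : ℝ)‖ₑ =
      ‖chartDeriv x₀ (extChartAt 𝓘(ℝ, E) x₀ (γ t))
        (derivWithin (fun s => extChartAt 𝓘(ℝ, E) x₀ (γ s)) (Icc 0 1) t)‖ₑ := by
  have ht' : γ t ∈ (extChartAt 𝓘(ℝ, E) x₀).source := hsrc.self_of_nhdsWithin ht
  have hA : γ t = (extChartAt 𝓘(ℝ, E) x₀).symm (extChartAt 𝓘(ℝ, E) x₀ (γ t)) :=
    ((extChartAt 𝓘(ℝ, E) x₀).left_inv ht').symm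
  have hB : mfderivWithin 𝓘(ℝ, ℝ) 𝓘(ℝ, E) γ (Icc 0 1) t =
      mfderivWithin 𝓘(ℝ, ℝ) 𝓘(ℝ, E)
        (fun s => (extChartAt 𝓘(ℝ, E) x₀).symm (extChartAt 𝓘(ℝ, E) x₀ (γ s))) (Icc 0 1) t := by
    refine Filter.EventuallyEq.mfderivWithin_eq ?_ hA
    filter_upwards [hsrc] with s hs using ((extChartAt 𝓘(ℝ, E) x₀).left_inv hs).symm
  exact (enorm_tangentSpace_congr (u := mfderivWithin 𝓘(ℝ, ℝ) 𝓘(ℝ, E) γ (Icc 0 1) t (1 : ℝ))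
    (w := mfderivWithin 𝓘(ℝ, ℝ) 𝓘(ℝ, E) (fun s => (extChartAt 𝓘(ℝ, E) x₀).symm
      (extChartAt 𝓘(ℝ, E) x₀ (γ s))) (Icc 0 1) t (1 : ℝ)) hA congr($hB (1 : ℝ))).trans (congrArg _
    (mfderivWithin_symm_comp zero_lt_one ht hc ((extChartAt 𝓘(ℝ, E) x₀).map_source ht')))

/-- Shortest paths parametrized proportionally to arc length are geodesics. -/
theorem isMinimizingGeodesic_of_dist_eq {γ : ℝ → M} {p q : M} (h0 : γ 0 = p) (h1 : γ 1 = q)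
    (hγ : ∀ s ∈ Icc (0 : ℝ) 1, ∀ t ∈ Icc (0 : ℝ) 1, dist (γ s) (γ t) = dist p q * |t - s|) :
    IsMinimizingGeodesic (E := E) γ p q := by
  have hmemd : ∀ {a b t v : _} {x₀ : M}, Icc a b ∈ 𝓝[Icc (0 : ℝ) 1] t →
      HasDerivWithinAt (fun s => extChartAt 𝓘(ℝ, E) x₀ (γ s)) v (Icc a b) t →
      HasDerivWithinAt (fun s => extChartAt 𝓘(ℝ, E) x₀ (γ s)) v (Icc 0 1) t :=
    fun hm hd => hd.mono_of_mem_nhdsWithin hm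
  have hsm : ContMDiffOn 𝓘(ℝ, ℝ) 𝓘(ℝ, E) 2 γ (Icc 0 1) := by
    intro t ht
    obtain ⟨a, b, v, hab, hnhds, hsub, hsrc, hv, hvt⟩ :=
      exists_chart_velocity dist_nonneg hγ (γ t) ht (mem_extChartAt_source (I := 𝓘(ℝ, E)) _)
    have hc : ContDiffOn ℝ 2 (fun s => extChartAt 𝓘(ℝ, E) (γ t) (γ s)) (Icc a b) := by
      rw [show (2 : WithTop ℕ∞) = 1 + 1 from by norm_num,
        contDiffOn_succ_iff_derivWithin (uniqueDiffOn_Icc hab)]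
      exact ⟨fun s hs => (hvt s hs).1.differentiableWithinAt, by simp,
        hv.congr fun s hs => (hvt s hs).1.derivWithin (uniqueDiffOn_Icc hab s hs)⟩
    have htab : t ∈ Icc a b := mem_of_mem_nhdsWithin ht hnhds
    have hcm := contMDiffWithinAt_iff_contDiffWithinAt.2
      ((hc t htab).mono_of_mem_nhdsWithin hnhds)
    have hcomp := ((contMDiffOn_extChartAt_symm (I := 𝓘(ℝ, E)) (n := 2) (γ t)).contMDiffAt
      (extChartAt_target_mem_nhds (I := 𝓘(ℝ, E)) (γ t))).comp_contMDiffWithinAt t hcm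
    refine hcomp.congr_of_eventuallyEq ?_ ?_
    · filter_upwards [hnhds] with s hs using ((extChartAt 𝓘(ℝ, E) (γ t)).left_inv (hsrc s hs)).symm
    · exact ((extChartAt 𝓘(ℝ, E) (γ t)).left_inv (hsrc t htab)).symm
  refine ⟨⟨hsm, fun x₀ t ht htsrc w => ?_⟩, h0, h1, le_antisymm ?_ ?_⟩
  · obtain ⟨a, b, v, hab, hnhds, hsub, hsrc, hv, hvt⟩ :=
      exists_chart_velocity dist_nonneg hγ x₀ ht (extChartAt_source (I := 𝓘(ℝ, E)) x₀ ▸ htsrc)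
    have htab : t ∈ Icc a b := mem_of_mem_nhdsWithin ht hnhds
    -- Agreement of the derivative with `v` is needed near `t`, not only at `t`, in order to
    -- differentiate once more.
    have hev : ∀ᶠ s in 𝓝[Icc 0 1] t,
        derivWithin (fun s => extChartAt 𝓘(ℝ, E) x₀ (γ s)) (Icc 0 1) s = v s := by
      filter_upwards [eventually_eventually_nhdsWithin.2 hnhds, self_mem_nhdsWithin] with s hs hs01
      exact (hmemd hs (hvt s (mem_of_mem_nhdsWithin hs01 hs)).1).derivWithin
        (uniqueDiffOn_Icc zero_lt_one s hs01)
    have h1 := hev.self_of_nhdsWithin ht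
    have h2 : iteratedDerivWithin 2 (fun s => extChartAt 𝓘(ℝ, E) x₀ (γ s)) (Icc 0 1) t =
        derivWithin v (Icc a b) t := by
      rw [iteratedDerivWithin_succ]
      have : iteratedDerivWithin 1 (fun s => extChartAt 𝓘(ℝ, E) x₀ (γ s)) (Icc 0 1) =ᶠ[𝓝[Icc 0 1] t]
          v := by
        filter_upwards [hev] with s hs
        rw [iteratedDerivWithin_one, hs]
      rw [this.derivWithin_eq (this.self_of_nhdsWithin ht)]
      exact ((hv.differentiableOn one_ne_zero t htab).hasDerivWithinAt.mono_of_mem_nhdsWithin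
        hnhds).derivWithin (uniqueDiffOn_Icc zero_lt_one t ht)
    intro c
    have h3 := (hvt t htab).2 w
    rw [← h1, ← h2] at h3
    exact h3
  · rw [pathELength_eq_lintegral_mfderivWithin_Icc, ← IsRiemannianManifold.out, edist_dist]
    calc ∫⁻ t in Icc (0 : ℝ) 1, ‖mfderivWithin 𝓘(ℝ, ℝ) 𝓘(ℝ, E) γ (Icc 0 1) t (1 : ℝ)‖ₑ
        ≤ ∫⁻ t in Icc (0 : ℝ) 1, ENNReal.ofReal (dist p q) := by
          -- The end points are discarded because the speed bound needs a two-sided derivative.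
          rw [← restrict_Ioo_eq_restrict_Icc]
          refine setLIntegral_mono' measurableSet_Ioo fun t ht => ?_
          have ht01 := Ioo_subset_Icc_self ht
          obtain ⟨a, b, v, hab, hnhds, hsub, hsrc, hv, hvt⟩ :=
            exists_chart_velocity dist_nonneg hγ (γ t) ht01
              (mem_extChartAt_source (I := 𝓘(ℝ, E)) _)
          have hd := hmemd hnhds (hvt t (mem_of_mem_nhdsWithin ht01 hnhds)).1
          rw [enorm_mfderivWithin_eq ht01 (x₀ := γ t) (by filter_upwards [hnhds] using hsrc)
            hd.differentiableWithinAt, ← ofReal_norm, norm_chartDeriv]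
          refine ENNReal.ofReal_le_ofReal ?_
          rw [Real.sqrt_le_left dist_nonneg, hd.derivWithin (uniqueDiffOn_Icc zero_lt_one t ht01)]
          refine (isMetricChart (γ t)).apply_deriv_le (c := fun s => extChartAt 𝓘(ℝ, E) (γ t) (γ s))
            dist_nonneg (hd.hasDerivAt (Icc_mem_nhds ht.1 ht.2)) (mem_extChartAt_target _) ?_
          have hn : 𝓝[>] t ≤ 𝓝[Icc 0 1] t := by
            rw [nhdsWithin_eq_nhds.2 (Icc_mem_nhds ht.1 ht.2)]; exact nhdsWithin_le_nhds
          filter_upwards [hn hnhds] with s hs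
          rw [(extChartAt 𝓘(ℝ, E) (γ t)).left_inv (hsrc s hs), extChartAt_to_inv]
          exact (hγ t ht01 s (hsub hs)).le
      _ = ENNReal.ofReal (dist p q) := by simp
  · exact riemannianEDist_le_pathELength (hsm.of_le one_le_two) h0 h1 zero_le_one

variable (E) in
/-- The Hopf-Rinow theorem. -/
theorem exists_isMinimizingGeodesic [CompleteSpace M] (p q : M) :
    ∃ γ : ℝ → M, IsMinimizingGeodesic (E := E) γ p q := by
  have : ProperSpace E := FiniteDimensional.proper ℝ E
  have : LocallyCompactSpace M := ChartedSpace.locallyCompactSpace E M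
  obtain ⟨γ, h0, h1, hγ⟩ := (hasApproxBetween E M).exists_geodesic p q
  exact ⟨γ, isMinimizingGeodesic_of_dist_eq h0 h1 hγ⟩

end RadialConvexity

/-! ### Uniqueness of geodesics -/

lemma ContDiffAt.flip_apply {E F G : Type*} [NormedAddCommGroup E] [NormedSpace ℝ E]
    [NormedAddCommGroup F] [NormedSpace ℝ F] [NormedAddCommGroup G] [NormedSpace ℝ G]
    {n : WithTop ℕ∞} {D : F → E →L[ℝ] E →L[ℝ] G} {v : F → E} {x : F}
    (hD : ContDiffAt ℝ n D x) (hv : ContDiffAt ℝ n v x) :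
    ContDiffAt ℝ n (fun z => (D z).flip (v z)) x :=
  ((ContinuousLinearMap.flipₗᵢ ℝ E E G).contDiff.contDiffAt.comp x hD).clm_apply hv

lemma ContDiffAt.trilinearForce {E F : Type*} [NormedAddCommGroup E] [NormedSpace ℝ E]
    [NormedAddCommGroup F] [NormedSpace ℝ F] {n : WithTop ℕ∞}
    {D : F → E →L[ℝ] E →L[ℝ] E →L[ℝ] ℝ} {v : F → E} {x : F}
    (hD : ContDiffAt ℝ n D x) (hv : ContDiffAt ℝ n v x) :
    ContDiffAt ℝ n (fun z => _root_.trilinearForce (D z) (v z)) x :=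
  (hD.flip_apply hv).flip_apply hv
/-- The geodesic vector field of a metric `G`, on pairs of a point and a velocity. -/
noncomputable def geodesicField {E : Type*} [NormedAddCommGroup E] [NormedSpace ℝ E]
    (G : E → E →L[ℝ] E →L[ℝ] ℝ) (z : E × E) : E × E :=
  (z.2, (G z.1).inverse ((1 / 2 : ℝ) • trilinearForce (fderiv ℝ G z.1) z.2
    - fderiv ℝ G z.1 z.2 z.2))

namespace IsMetricChart

variable {E X : Type*} [NormedAddCommGroup E] [NormedSpace ℝ E] [FiniteDimensional ℝ E]
  [PseudoMetricSpace X] {U : Set E} {G : E → E →L[ℝ] E →L[ℝ] ℝ} {ψ : E → X}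

lemma contDiffAt_geodesicField (h : IsMetricChart U G ψ) {z : E × E} (hz : z.1 ∈ U) :
    ContDiffAt ℝ ∞ (geodesicField G) z := by
  have hD : ContDiffAt ℝ ∞ (fun z : E × E => fderiv ℝ G z.1) z :=
    (h.contDiffAt_fderiv hz).comp z contDiffAt_fst
  have h1 : ContDiffAt ℝ ∞ (fun z : E × E => trilinearForce (fderiv ℝ G z.1) z.2) z :=
    hD.trilinearForce contDiffAt_snd
  have h2 : ContDiffAt ℝ ∞ (fun z : E × E => fderiv ℝ G z.1 z.2 z.2) z :=
    (hD.clm_apply contDiffAt_snd).clm_apply contDiffAt_snd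
  have h3 : ContDiffAt ℝ ∞ (fun z : E × E => (G z.1).inverse) z :=
    (h.contDiffAt_inverse hz).comp z contDiffAt_fst
  have h4 : ContDiffAt ℝ ∞ (fun z : E × E => (1 / 2 : ℝ) • trilinearForce (fderiv ℝ G z.1) z.2
      - fderiv ℝ G z.1 z.2 z.2) z := (h1.const_smul _).sub h2
  have h5 : ContDiffAt ℝ ∞ (fun z : E × E => (G z.1).inverse ((1 / 2 : ℝ) •
      trilinearForce (fderiv ℝ G z.1) z.2 - fderiv ℝ G z.1 z.2 z.2)) z := h3.clm_apply h4
  exact contDiffAt_snd.prodMk h5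

end IsMetricChart

namespace RadialConvexity

section Derivative

variable {E : Type*} [NormedAddCommGroup E] [NormedSpace ℝ E]
  {M : Type*} [TopologicalSpace M] [ChartedSpace E M]
  [RiemannianBundle (fun x : M => TangentSpace 𝓘(ℝ, E) x)] {γ γ₁ γ₂ : ℝ → M}

lemma IsGeodesic.continuousOn (hγ : IsGeodesic (E := E) γ) : ContinuousOn γ (Icc 0 1) :=
  hγ.1.continuousOn

variable [IsManifold 𝓘(ℝ, E) ∞ M]

lemma IsGeodesic.hasDerivWithinAt (hγ : IsGeodesic (E := E) γ) {x₀ : M} {t : ℝ}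
    (ht : t ∈ Icc (0 : ℝ) 1) (hsrc : γ t ∈ (chartAt E x₀).source) :
    HasDerivWithinAt (fun s => extChartAt 𝓘(ℝ, E) x₀ (γ s))
      (derivWithin (fun s => extChartAt 𝓘(ℝ, E) x₀ (γ s)) (Icc 0 1) t) (Icc 0 1) t ∧
    HasDerivWithinAt (derivWithin (fun s => extChartAt 𝓘(ℝ, E) x₀ (γ s)) (Icc 0 1))
      (iteratedDerivWithin 2 (fun s => extChartAt 𝓘(ℝ, E) x₀ (γ s)) (Icc 0 1) t) (Icc 0 1) t := by
  have hc : ContDiffWithinAt ℝ 2 (fun s => extChartAt 𝓘(ℝ, E) x₀ (γ s)) (Icc 0 1) t := by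
    rw [← contMDiffWithinAt_iff_contDiffWithinAt]
    exact (contMDiffAt_extChartAt' (I := 𝓘(ℝ, E)) hsrc).comp_contMDiffWithinAt t (hγ.1 t ht)
  refine ⟨(hc.differentiableWithinAt two_ne_zero).hasDerivWithinAt, ?_⟩
  have h1 := ((hc.fderivWithin_right (m := 1) (uniqueDiffOn_Icc zero_lt_one) (by norm_num) ht
    ).differentiableWithinAt one_ne_zero).clm_apply (differentiableWithinAt_const (1 : ℝ))
  have h2 : DifferentiableWithinAt ℝ
      (derivWithin (fun s => extChartAt 𝓘(ℝ, E) x₀ (γ s)) (Icc 0 1)) (Icc 0 1) t := h1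
  rw [iteratedDerivWithin_succ, iteratedDerivWithin_one]
  exact h2.hasDerivWithinAt

/-- The initial velocity of a geodesic determines its initial velocity in a chart. -/
lemma HasInitialVelocity.derivWithin_eq {p : M} {v : TangentSpace 𝓘(ℝ, E) p}
    (h₁ : HasInitialVelocity (E := E) γ₁ p v) (h₂ : HasInitialVelocity (E := E) γ₂ p v)
    (hγ₁ : IsGeodesic (E := E) γ₁) (hγ₂ : IsGeodesic (E := E) γ₂) :
    derivWithin (fun s => extChartAt 𝓘(ℝ, E) p (γ₁ s)) (Icc 0 1) 0 =
      derivWithin (fun s => extChartAt 𝓘(ℝ, E) p (γ₂ s)) (Icc 0 1) 0 := by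
  have key : ∀ γ : ℝ → M, IsGeodesic (E := E) γ → HasInitialVelocity (E := E) γ p v →
      derivWithin (fun s => extChartAt 𝓘(ℝ, E) p (γ s)) (Icc 0 1) 0 =
        (tangentMap 𝓘(ℝ, E) 𝓘(ℝ, E) (extChartAt 𝓘(ℝ, E) p) ⟨p, v⟩).2 := by
    intro γ hγ h
    have h0 : (0 : ℝ) ∈ Icc (0 : ℝ) 1 := by simp
    have hp : γ 0 = p := congrArg (fun z : TangentBundle 𝓘(ℝ, E) M => z.1) h
    have hsrc : γ 0 ∈ (chartAt E p).source := by rw [hp]; exact mem_chart_source E p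
    rw [← h]
    have h1 := mfderiv_comp_mfderivWithin (I := 𝓘(ℝ, ℝ)) (I' := 𝓘(ℝ, E)) (I'' := 𝓘(ℝ, E))
      (f := γ) (s := Icc (0 : ℝ) 1) (0 : ℝ) (mdifferentiableAt_extChartAt hsrc)
      ((hγ.1 0 h0).mdifferentiableWithinAt two_ne_zero)
      (uniqueMDiffWithinAt_iff_uniqueDiffWithinAt.2 (uniqueDiffOn_Icc zero_lt_one 0 h0))
    have h2 := congr($h1 (1 : ℝ))
    refine Eq.trans ?_ h2
    rw [mfderivWithin_eq_fderivWithin, ← fderivWithin_derivWithin]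
    rfl
  rw [key γ₁ hγ₁ h₁, key γ₂ hγ₂ h₂]

end Derivative

variable {E : Type*} [NormedAddCommGroup E] [NormedSpace ℝ E] [FiniteDimensional ℝ E]
  {M : Type*} [MetricSpace M] [ChartedSpace E M] [IsManifold 𝓘(ℝ, E) ∞ M]
  [RiemannianBundle (fun x : M => TangentSpace 𝓘(ℝ, E) x)]
  [IsContMDiffRiemannianBundle 𝓘(ℝ, E) ∞ E (fun x : M => TangentSpace 𝓘(ℝ, E) x)]
  [IsRiemannianManifold 𝓘(ℝ, E) M] {γ γ₁ γ₂ : ℝ → M}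

/-- In a chart, a geodesic and its velocity form an integral curve of the geodesic vector field. -/
lemma IsGeodesic.hasDerivWithinAt_geodesicField (hγ : IsGeodesic (E := E) γ) {x₀ : M} {t : ℝ}
    (ht : t ∈ Icc (0 : ℝ) 1) (hsrc : γ t ∈ (chartAt E x₀).source) :
    HasDerivWithinAt (fun s => (extChartAt 𝓘(ℝ, E) x₀ (γ s),
        derivWithin (fun s => extChartAt 𝓘(ℝ, E) x₀ (γ s)) (Icc 0 1) s))
      (geodesicField (chartForm x₀) (extChartAt 𝓘(ℝ, E) x₀ (γ t),
        derivWithin (fun s => extChartAt 𝓘(ℝ, E) x₀ (γ s)) (Icc 0 1) t)) (Icc 0 1) t := by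
  obtain ⟨h1, h2⟩ := hγ.hasDerivWithinAt ht hsrc
  have htgt : extChartAt 𝓘(ℝ, E) x₀ (γ t) ∈ (extChartAt 𝓘(ℝ, E) x₀).target :=
    (extChartAt 𝓘(ℝ, E) x₀).map_source (extChartAt_source (I := 𝓘(ℝ, E)) x₀ ▸ hsrc)
  refine (h1.prodMk h2).congr_deriv (Prod.ext rfl ?_)
  refine (((isMetricChart x₀).isInvertible htgt).inverse_apply_eq.2 ?_).symm
  ext w
  have h3 := hγ.2 x₀ t ht hsrc w
  simp only [christoffel_self htgt] at h3
  simp only [sub_apply, smul_apply, trilinearForce_apply, smul_eq_mul, chartForm_apply]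
  linarith

/-- Two geodesics which have at some time the same position and velocity coincide for a short
time. -/
lemma IsGeodesic.eventuallyEq (hγ₁ : IsGeodesic (E := E) γ₁) (hγ₂ : IsGeodesic (E := E) γ₂)
    {x₀ : M} {t₀ : ℝ} (ht₀ : t₀ ∈ Ico (0 : ℝ) 1) (hsrc : γ₁ t₀ ∈ (chartAt E x₀).source)
    (heq : γ₁ t₀ = γ₂ t₀)
    (hv : derivWithin (fun s => extChartAt 𝓘(ℝ, E) x₀ (γ₁ s)) (Icc 0 1) t₀ =
      derivWithin (fun s => extChartAt 𝓘(ℝ, E) x₀ (γ₂ s)) (Icc 0 1) t₀) :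
    ∀ᶠ t in 𝓝[>] t₀, γ₁ t = γ₂ t := by
  have ht₀' : t₀ ∈ Icc (0 : ℝ) 1 := Ico_subset_Icc_self ht₀
  let f : (ℝ → M) → ℝ → E × E := fun γ s => (extChartAt 𝓘(ℝ, E) x₀ (γ s),
    derivWithin (fun s => extChartAt 𝓘(ℝ, E) x₀ (γ s)) (Icc 0 1) s)
  have hf : f γ₁ t₀ = f γ₂ t₀ := Prod.ext (by simp only [f, heq]) hv
  have htgt : (f γ₁ t₀).1 ∈ (extChartAt 𝓘(ℝ, E) x₀).target :=
    (extChartAt 𝓘(ℝ, E) x₀).map_source (extChartAt_source (I := 𝓘(ℝ, E)) x₀ ▸ hsrc)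
  -- The geodesic field is smooth, hence Lipschitz on a neighbourhood `N` of the common state. Both
  -- curves stay in `N` up to time `b`, so uniqueness for ODEs applies.
  obtain ⟨K, N, hN, hlip⟩ := (((isMetricChart x₀).contDiffAt_geodesicField htgt).of_le
    (by norm_cast)).exists_lipschitzOnWith
  have hnear : ∀ γ : ℝ → M, IsGeodesic (E := E) γ → γ t₀ = γ₁ t₀ → f γ t₀ = f γ₁ t₀ →
      ∀ᶠ t in 𝓝[Icc 0 1] t₀, f γ t ∈ N ∧ γ t ∈ (chartAt E x₀).source := by
    intro γ hγ h1 h2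
    have hs : γ t₀ ∈ (chartAt E x₀).source := h1 ▸ hsrc
    exact ((hγ.hasDerivWithinAt_geodesicField ht₀' hs).continuousWithinAt.eventually
      (show ∀ᶠ z in 𝓝 (f γ t₀), z ∈ N from h2 ▸ hN)).and
      ((hγ.continuousOn t₀ ht₀').eventually ((chartAt E x₀).open_source.eventually_mem hs))
  obtain ⟨δ, hδ, hsub⟩ := Metric.mem_nhdsWithin_iff.1
    ((hnear γ₁ hγ₁ rfl rfl).and (hnear γ₂ hγ₂ heq.symm hf.symm))
  let b := min 1 (t₀ + δ / 2)
  have hb : t₀ < b := lt_min ht₀.2 (by linarith)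
  have hsub01 : Icc t₀ b ⊆ Icc 0 1 := Icc_subset_Icc ht₀.1 (min_le_left _ _)
  have hgood : ∀ t ∈ Icc t₀ b, (f γ₁ t ∈ N ∧ γ₁ t ∈ (chartAt E x₀).source) ∧
      (f γ₂ t ∈ N ∧ γ₂ t ∈ (chartAt E x₀).source) := fun t ht => by
    refine hsub ⟨?_, hsub01 ht⟩
    have h1 := ht.2.trans (min_le_right _ _)
    rw [Metric.mem_ball, Real.dist_eq, abs_lt]
    constructor <;> linarith [ht.1]
  have hder : ∀ γ : ℝ → M, IsGeodesic (E := E) γ →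
      (∀ t ∈ Icc t₀ b, γ t ∈ (chartAt E x₀).source) → ContinuousOn (f γ) (Icc t₀ b) ∧
      ∀ t ∈ Ico t₀ b, HasDerivWithinAt (f γ) (geodesicField (chartForm x₀) (f γ t)) (Ici t) t := by
    intro γ hγ hs
    refine ⟨fun t ht => (hγ.hasDerivWithinAt_geodesicField (hsub01 ht)
      (hs t ht)).continuousWithinAt.mono hsub01, fun t ht => ?_⟩
    refine (hγ.hasDerivWithinAt_geodesicField (hsub01 (Ico_subset_Icc_self ht))
      (hs t (Ico_subset_Icc_self ht))).mono_of_mem_nhdsWithin ?_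
    exact mem_of_superset (Icc_mem_nhdsGE_of_mem ⟨le_rfl, ht.2⟩)
      ((Icc_subset_Icc_left ht.1).trans hsub01)
  obtain ⟨hc₁, hd₁⟩ := hder γ₁ hγ₁ fun t ht => (hgood t ht).1.2
  obtain ⟨hc₂, hd₂⟩ := hder γ₂ hγ₂ fun t ht => (hgood t ht).2.2
  have hode := ODE_solution_unique_of_mem_Icc_right (v := fun _ => geodesicField (chartForm x₀))
    (s := fun _ => N) (fun _ _ => hlip) hc₁ hd₁
    (fun t ht => (hgood t (Ico_subset_Icc_self ht)).1.1) hc₂ hd₂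
    (fun t ht => (hgood t (Ico_subset_Icc_self ht)).2.1) hf
  filter_upwards [Icc_mem_nhdsGT hb] with t ht
  have h1 : extChartAt 𝓘(ℝ, E) x₀ (γ₁ t) = extChartAt 𝓘(ℝ, E) x₀ (γ₂ t) :=
    congrArg Prod.fst (hode ht)
  refine (extChartAt 𝓘(ℝ, E) x₀).injOn ?_ ?_ h1 <;> rw [extChartAt_source]
  exacts [(hgood t ht).1.2, (hgood t ht).2.2]

/-- A geodesic is determined by its initial velocity. -/
theorem IsGeodesic.eqOn (hγ₁ : IsGeodesic (E := E) γ₁) (hγ₂ : IsGeodesic (E := E) γ₂) {p : M}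
    {v : TangentSpace 𝓘(ℝ, E) p} (h₁ : HasInitialVelocity (E := E) γ₁ p v)
    (h₂ : HasInitialVelocity (E := E) γ₂ p v) : EqOn γ₁ γ₂ (Icc 0 1) := by
  have hp₁ : γ₁ 0 = p := congrArg (fun z : TangentBundle 𝓘(ℝ, E) M => z.1) h₁
  have hp₂ : γ₂ 0 = p := congrArg (fun z : TangentBundle 𝓘(ℝ, E) M => z.1) h₂
  have hclosed : IsClosed ({t | γ₁ t = γ₂ t} ∩ Icc (0 : ℝ) 1) := by
    rw [inter_comm]
    exact (hγ₁.continuousOn.prodMk hγ₂.continuousOn).preimage_isClosed_of_isClosed isClosed_Icc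
      isClosed_diagonal
  -- Continuous induction: the agreement set is closed, and agreement on `[0, t]` extends a little
  -- beyond `t`.
  refine hclosed.Icc_subset_of_forall_mem_nhdsGT_of_Icc_subset (hp₁.trans hp₂.symm)
    fun t ht hsub => ?_
  have heq : γ₁ t = γ₂ t := hsub ⟨ht.1, le_rfl⟩
  have ht' : t ∈ Icc (0 : ℝ) 1 := Ico_subset_Icc_self ht
  rcases ht.1.eq_or_lt with rfl | hpos
  · exact hγ₁.eventuallyEq hγ₂ ht (x₀ := p) (by rw [hp₁]; exact mem_chart_source E p) heq
      (h₁.derivWithin_eq h₂ hγ₁ hγ₂)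
  · have hs₁ : γ₁ t ∈ (chartAt E (γ₁ t)).source := mem_chart_source E _
    refine hγ₁.eventuallyEq hγ₂ ht (x₀ := γ₁ t) hs₁ heq ?_
    -- At `t > 0` the velocities are left derivatives on `[0, t]`, where the curves already agree.
    have hmono : Icc 0 t ⊆ Icc 0 1 := Icc_subset_Icc_right ht.2.le
    have htt : t ∈ Icc 0 t := ⟨ht.1, le_rfl⟩
    have hu := uniqueDiffOn_Icc hpos t htt
    have hd₁ := ((hγ₁.hasDerivWithinAt ht' hs₁).1.mono hmono).derivWithin hu
    have hs₂ : γ₂ t ∈ (chartAt E (γ₁ t)).source := by rw [← heq]; exact hs₁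
    have hd₂ := ((hγ₂.hasDerivWithinAt ht' hs₂).1.mono hmono).derivWithin hu
    rw [← hd₁, ← hd₂]
    exact derivWithin_congr (fun s hs => congrArg _ (hsub hs)) (congrArg _ heq)

/-! ### Direction functions adapted to a convex set -/

omit [FiniteDimensional ℝ E] [IsManifold 𝓘(ℝ, E) ∞ M]
  [RiemannianBundle (fun x : M => TangentSpace 𝓘(ℝ, E) x)]
  [IsContMDiffRiemannianBundle 𝓘(ℝ, E) ∞ E (fun x : M => TangentSpace 𝓘(ℝ, E) x)]
  [IsRiemannianManifold 𝓘(ℝ, E) M] in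
lemma exists_hasInitialVelocity {p : M} (h : γ 0 = p) :
    ∃ v : TangentSpace 𝓘(ℝ, E) p, HasInitialVelocity (E := E) γ p v := by
  subst h
  exact ⟨_, rfl⟩

variable (E) in
/-- In a geodesically convex set, the geodesics of a suitable direction function at a point of the
set stay in the set. -/
lemma IsGeodesicallyConvex.exists_directionFunction [CompleteSpace M] {A : Set M}
    (hA : IsGeodesicallyConvex E A) {p : M} (hp : p ∈ A) :
    ∃ η : DirectionFunction E p, ∀ x ∈ A, ∀ t ∈ Icc (0 : ℝ) 1, η.geodesic x t ∈ A := by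
  have hex : ∀ x, ∃ γ : ℝ → M, IsMinimizingGeodesic (E := E) γ p x ∧
      (x ∈ A → ∀ t ∈ Icc (0 : ℝ) 1, γ t ∈ A) := by
    intro x
    by_cases hx : x ∈ A
    · obtain ⟨γ, h1, h2⟩ := hA p hp x hx
      exact ⟨γ, h1, fun _ => h2⟩
    · obtain ⟨γ, h⟩ := exists_isMinimizingGeodesic E p x
      exact ⟨γ, h, fun h' => absurd h' hx⟩
  choose γ hγ hγA using hex
  choose v hv using fun x => exists_hasInitialVelocity (E := E) (hγ x).source
  let η : DirectionFunction E p := ⟨v, fun x => ⟨γ x, hγ x, hv x⟩⟩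
  refine ⟨η, fun x hx t ht => ?_⟩
  obtain ⟨h1, h2⟩ := (η.mem_initialDirections x).choose_spec
  -- The geodesic of `η` is an arbitrary choice with the prescribed initial velocity; uniqueness
  -- identifies it with `γ x`.
  have h3 : η.geodesic x t = γ x t := h1.isGeodesic.eqOn (hγ x).isGeodesic h2 (hv x) ht
  rw [h3]
  exact hγA x hx t ht

omit [FiniteDimensional ℝ E] [IsManifold 𝓘(ℝ, E) ∞ M]
  [IsContMDiffRiemannianBundle 𝓘(ℝ, E) ∞ E (fun x : M => TangentSpace 𝓘(ℝ, E) x)]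
  [IsRiemannianManifold 𝓘(ℝ, E) M] in
lemma radialContraction_one {p : M} (η : DirectionFunction E p) (x : M) :
    radialContraction η 1 x = x :=
  (η.mem_initialDirections x).choose_spec.1.target

end RadialConvexity

end

theorem mainTheorem1
    {E : Type*} [NormedAddCommGroup E] [NormedSpace ℝ E] [FiniteDimensional ℝ E]
    {M : Type*} [MetricSpace M] [ChartedSpace E M] [IsManifold 𝓘(ℝ, E) ∞ M]
    [RiemannianBundle (fun x : M => TangentSpace 𝓘(ℝ, E) x)]
    [IsContMDiffRiemannianBundle 𝓘(ℝ, E) ∞ E (fun x : M => TangentSpace 𝓘(ℝ, E) x)]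
    [IsRiemannianManifold 𝓘(ℝ, E) M] [ConnectedSpace M] [CompleteSpace M]
    (A : Set M) (hA : 2 < A.encard) :
    RadialConvexity.IsGeodesicallyConvex E A ↔
      ∀ p ∈ A, ∃ η : RadialConvexity.DirectionFunction E p,
        ∀ r ∈ Ioc (0 : ℝ) 1, RadialConvexity.IsRadiallyConvex η r A := by
  constructor
  · intro h p hp
    obtain ⟨η, hη⟩ := h.exists_directionFunction E hp
    exact ⟨η, fun r hr => ⟨⟨p, hp⟩, fun x hx y hy =>
      h _ (hη x hx r ⟨hr.1.le, hr.2⟩) _ (hη y hy r ⟨hr.1.le, hr.2⟩)⟩⟩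
  · intro h x hx y hy
    obtain ⟨η, hη⟩ := h x hx
    -- The factor `1`, based at `x` itself, is enough.
    obtain ⟨γ, hγ, hγA⟩ := (hη 1 ⟨zero_lt_one, le_rfl⟩).2 x hx y hy
    rw [RadialConvexity.radialContraction_one, RadialConvexity.radialContraction_one] at hγ
    exact ⟨γ, hγ, hγA⟩
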